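/- Let $k$ be a field and let $(C,\Delta,\varepsilon)$ be a coalgebra over $k$. Let $C_0$ be the coradical of $C$ (the sum of all simple subcoalgebras), let $C_{n+1}=\Delta^{-1}(C_n\otimes C+C\otimes C_0)$ for $n\ge 0$, so that $C_0\subseteq C_1\subseteq\cdots$ is the coradical filtration of $C$, and put $C_{-1}=0$. Let $\operatorname{gr} C=\bigoplus_{n\ge 0}C_n/C_{n-1}$ be the associated graded coalgebra: its comultiplication sends the class of $c\in C_n$ to the element of $\bigoplus_{i+j=n}C_i/C_{i-1}\otimes C_j/C_{j-1}$ whose $(i,j)$-component is the image of $\Delta(c)$ under the projection $C\otimes C\to C/C_{i-1}\otimes C/C_{j-1}$, and its counit is $\varepsilon$ on $C_0$ and $0$ on $C_n/C_{n-1}$ for $n\ge 1$. A coalgebra $D$ is called left semiperfect if the injective envelope, in the category of right $D$-comodules, of every simple right $D$-comodule is finite-dimensional. Then $C$ is left semiperfect if and only if $\operatorname{gr} C$ is left semiperfect. -/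

import Mathlib

open scoped TensorProduct DirectSum

universe u v

/-! ### Subcoalgebras, the wedge product and the coradical filtration -/

section Filtration

variable (k : Type u) {C : Type v} [Field k] [AddCommGroup C] [Module k C] [Coalgebra k C]

/-- A subspace `D` of a coalgebra `C` is a subcoalgebra if `Δ(D) ⊆ D ⊗ D`. -/
def IsSubcoalgebra (D : Submodule k C) : Prop :=
  ∀ x ∈ D, Coalgebra.comul (R := k) x ∈ LinearMap.range (TensorProduct.map D.subtype D.subtype)

/-- A simple subcoalgebra: a nonzero subcoalgebra whose only subcoalgebras are `0` and itself. -/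
def IsSimpleSubcoalgebra (D : Submodule k C) : Prop :=
  IsSubcoalgebra k D ∧ D ≠ ⊥ ∧ ∀ D' : Submodule k C, IsSubcoalgebra k D' → D' ≤ D → D' = ⊥ ∨ D' = D

variable (C) in
/-- The coradical `C₀`: the sum of all simple subcoalgebras. -/
def coradical : Submodule k C := sSup {D | IsSimpleSubcoalgebra k D}

/-- The wedge `X ∧ Y = Δ⁻¹(X ⊗ C + C ⊗ Y)`. -/
def wedge (X Y : Submodule k C) : Submodule k C :=
  Submodule.comap Coalgebra.comul
    (LinearMap.range (LinearMap.rTensor C X.subtype) ⊔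
      LinearMap.range (LinearMap.lTensor C Y.subtype))

variable (C) in
/-- The coradical filtration: `C₀` is the coradical and `Cₙ₊₁ = Cₙ ∧ C₀`. -/
def coradicalFiltration : ℕ → Submodule k C
  | 0 => coradical k C
  | n + 1 => wedge k (coradicalFiltration n) (coradical k C)

variable (C) in
/-- The shifted filtration `n ↦ Cₙ₋₁`, with `C₋₁ = 0`. -/
def coradicalFiltrationPred : ℕ → Submodule k C
  | 0 => ⊥
  | n + 1 => coradicalFiltration k C n

variable {k}

theorem mem_wedge_iff (X Y : Submodule k C) (x : C) :
    x ∈ wedge k X Y ↔ TensorProduct.map X.mkQ Y.mkQ (Coalgebra.comul (R := k) x) = 0 := by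
  rw [← LinearMap.mem_ker, TensorProduct.map_ker (LinearMap.exact_subtype_mkQ X) X.mkQ_surjective
      (LinearMap.exact_subtype_mkQ Y) Y.mkQ_surjective, sup_comm]
  rfl

theorem wedge_mono {X X' Y Y' : Submodule k C} (hX : X ≤ X') (hY : Y ≤ Y') :
    wedge k X Y ≤ wedge k X' Y' := by
  intro x hx
  rw [mem_wedge_iff] at hx ⊢
  have h1 : X'.mkQ = X.factor hX ∘ₗ X.mkQ := by ext; rfl
  have h2 : Y'.mkQ = Y.factor hY ∘ₗ Y.mkQ := by ext; rfl
  rw [h1, h2, TensorProduct.map_comp, LinearMap.comp_apply, hx, map_zero]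

/-- The injection `C / (X ∧ Y) → C/X ⊗ C/Y` induced by `Δ`. -/
noncomputable def wedgeQuot (X Y : Submodule k C) : C ⧸ wedge k X Y →ₗ[k] (C ⧸ X) ⊗[k] (C ⧸ Y) :=
  (wedge k X Y).liftQ (TensorProduct.map X.mkQ Y.mkQ ∘ₗ Coalgebra.comul)
    (fun x hx => (mem_wedge_iff X Y x).1 hx)

theorem wedgeQuot_comp (X Y : Submodule k C) :
    wedgeQuot X Y ∘ₗ (wedge k X Y).mkQ = TensorProduct.map X.mkQ Y.mkQ ∘ₗ Coalgebra.comul :=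
  Submodule.liftQ_mkQ _ _ _

theorem wedgeQuot_injective (X Y : Submodule k C) : Function.Injective (wedgeQuot X Y) := by
  exact LinearMap.ker_eq_bot.1 (Submodule.ker_liftQ_eq_bot _ _ _
    (fun x hx => (mem_wedge_iff X Y x).2 hx))

theorem wedge_assoc (X Y Z : Submodule k C) :
    wedge k (wedge k X Y) Z = wedge k X (wedge k Y Z) := by
  ext x
  have inj1 : Function.Injective (LinearMap.lTensor (C ⧸ X) (wedgeQuot Y Z)) :=
    Module.Flat.lTensor_preserves_injective_linearMap _ (wedgeQuot_injective Y Z)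
  have inj2 : Function.Injective (LinearMap.rTensor (C ⧸ Z) (wedgeQuot X Y)) :=
    Module.Flat.rTensor_preserves_injective_linearMap _ (wedgeQuot_injective X Y)
  have e1 : LinearMap.lTensor (C ⧸ X) (wedgeQuot Y Z) ∘ₗ
      TensorProduct.map X.mkQ (wedge k Y Z).mkQ
      = TensorProduct.map X.mkQ (TensorProduct.map Y.mkQ Z.mkQ) ∘ₗ
        LinearMap.lTensor C Coalgebra.comul := by
    rw [LinearMap.lTensor_comp_map, wedgeQuot_comp, LinearMap.map_comp_lTensor]
  have e2 : LinearMap.rTensor (C ⧸ Z) (wedgeQuot X Y) ∘ₗ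
      TensorProduct.map (wedge k X Y).mkQ Z.mkQ
      = TensorProduct.map (TensorProduct.map X.mkQ Y.mkQ) Z.mkQ ∘ₗ
        LinearMap.rTensor C Coalgebra.comul := by
    rw [LinearMap.rTensor_comp_map, wedgeQuot_comp, LinearMap.map_comp_rTensor]
  have h1 := LinearMap.congr_fun e1 (Coalgebra.comul (R := k) x)
  have h2 := LinearMap.congr_fun e2 (Coalgebra.comul (R := k) x)
  simp only [LinearMap.comp_apply] at h1 h2
  have e3 := TensorProduct.map_map_assoc X.mkQ Y.mkQ Z.mkQ
    (LinearMap.rTensor C Coalgebra.comul (Coalgebra.comul (R := k) x))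
  rw [Coalgebra.coassoc_apply, ← h1, ← h2] at e3
  rw [mem_wedge_iff, mem_wedge_iff, ← map_eq_zero_iff _ inj1, ← map_eq_zero_iff _ inj2, e3,
    LinearEquiv.map_eq_zero_iff]

theorem wedge_bot_left_le (Y : Submodule k C) : wedge k ⊥ Y ≤ Y := by
  intro x hx
  rw [mem_wedge_iff] at hx
  have h := congrArg (LinearMap.rTensor (C ⧸ Y)
    ((⊥ : Submodule k C).liftQ (Coalgebra.counit (R := k)) bot_le)) hx
  rw [map_zero, ← LinearMap.comp_apply, LinearMap.rTensor_comp_map, Submodule.liftQ_mkQ,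
    ← LinearMap.lTensor_comp_rTensor, LinearMap.comp_apply, Coalgebra.rTensor_counit_comul,
    LinearMap.lTensor_tmul] at h
  have h' := congrArg (TensorProduct.lid k _) h
  simpa using h'

theorem IsSubcoalgebra.le_wedge {D : Submodule k C} (h : IsSubcoalgebra k D) (X : Submodule k C) :
    D ≤ wedge k X D ∧ D ≤ wedge k D X := by
  constructor
  · intro x hx
    obtain ⟨t, ht⟩ := h x hx
    rw [mem_wedge_iff, ← ht, ← LinearMap.comp_apply, ← TensorProduct.map_comp,
      (LinearMap.exact_subtype_mkQ D).linearMap_comp_eq_zero, TensorProduct.map_zero_right,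
      LinearMap.zero_apply]
  · intro x hx
    obtain ⟨t, ht⟩ := h x hx
    rw [mem_wedge_iff, ← ht, ← LinearMap.comp_apply, ← TensorProduct.map_comp,
      (LinearMap.exact_subtype_mkQ D).linearMap_comp_eq_zero, TensorProduct.map_zero_left,
      LinearMap.zero_apply]

theorem coradical_le_wedge (X : Submodule k C) :
    coradical k C ≤ wedge k X (coradical k C) ∧ coradical k C ≤ wedge k (coradical k C) X := by
  constructor
  · exact sSup_le fun D hD => (hD.1.le_wedge X).1.trans (wedge_mono le_rfl (le_sSup hD))
  · exact sSup_le fun D hD => (hD.1.le_wedge X).2.trans (wedge_mono (le_sSup hD) le_rfl)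

theorem coradicalFiltrationPred_succ (n : ℕ) : coradicalFiltrationPred k C (n + 1) =
    wedge k (coradicalFiltrationPred k C n) (coradical k C) := by
  cases n with
  | zero => exact le_antisymm (coradical_le_wedge ⊥).1 (wedge_bot_left_le _)
  | succ n => rfl

theorem coradicalFiltrationPred_add_le (i j : ℕ) : coradicalFiltrationPred k C (i + j) ≤
    wedge k (coradicalFiltrationPred k C i) (coradicalFiltrationPred k C j) := by
  induction j with
  | zero =>
    cases i with
    | zero => exact bot_le
    | succ i =>
      rw [add_zero, coradicalFiltrationPred_succ]
      change _ ≤ wedge k _ ⊥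
      rw [wedge_assoc]
      exact wedge_mono le_rfl (coradical_le_wedge ⊥).2
  | succ j ih =>
    rw [← add_assoc, coradicalFiltrationPred_succ, coradicalFiltrationPred_succ]
    exact (wedge_mono ih le_rfl).trans (wedge_assoc _ _ _).le

end Filtration

/-! ### The associated graded coalgebra -/

section Graded

variable (k : Type u) (C : Type v) [Field k] [AddCommGroup C] [Module k C] [Coalgebra k C]

/-- The homogeneous component `gr C (n) = Cₙ / Cₙ₋₁`, realised as the subspace of `C / Cₙ₋₁`
which is the image of `Cₙ`. -/
def grComponent (n : ℕ) : Submodule k (C ⧸ coradicalFiltrationPred k C n) :=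
  (coradicalFiltration k C n).map (coradicalFiltrationPred k C n).mkQ

/-- The space `gr C = ⨁ₙ Cₙ / Cₙ₋₁`. -/
def Gr : Type v := ⨁ n : ℕ, grComponent k C n

noncomputable instance : AddCommGroup (Gr k C) :=
  inferInstanceAs (AddCommGroup (⨁ n : ℕ, grComponent k C n))

noncomputable instance : Module k (Gr k C) :=
  inferInstanceAs (Module k (⨁ n : ℕ, grComponent k C n))

/-- The inclusion of the component of degree `n` into `gr C`. -/
noncomputable def Gr.of (n : ℕ) : grComponent k C n →ₗ[k] Gr k C :=
  DirectSum.lof k ℕ (fun n => grComponent k C n) n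

/-- The projection `πₙ : Cₙ → Cₙ / Cₙ₋₁`. -/
def Gr.mk (n : ℕ) : coradicalFiltration k C n →ₗ[k] grComponent k C n :=
  (coradicalFiltrationPred k C n).mkQ.submoduleMap (coradicalFiltration k C n)

variable {k C}

theorem Gr.mk_surjective (n : ℕ) : Function.Surjective (Gr.mk k C n) :=
  LinearMap.submoduleMap_surjective _ _

/-- For `i + j = n`, the map `C / Cₙ₋₁ → C / Cᵢ₋₁ ⊗ C / Cⱼ₋₁` induced by `Δ`. -/
noncomputable def quotComul {n i j : ℕ} (h : i + j = n) : C ⧸ coradicalFiltrationPred k C n →ₗ[k]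
    (C ⧸ coradicalFiltrationPred k C i) ⊗[k] (C ⧸ coradicalFiltrationPred k C j) :=
  (coradicalFiltrationPred k C n).liftQ
    (TensorProduct.map (coradicalFiltrationPred k C i).mkQ (coradicalFiltrationPred k C j).mkQ ∘ₗ
      Coalgebra.comul)
    (fun x hx => (mem_wedge_iff _ _ x).1 (coradicalFiltrationPred_add_le i j (h ▸ hx)))

/-- The inclusion `Cᵢ/Cᵢ₋₁ ⊗ Cⱼ/Cⱼ₋₁ → C/Cᵢ₋₁ ⊗ C/Cⱼ₋₁`. -/
noncomputable def grTensorIncl (i j : ℕ) : grComponent k C i ⊗[k] grComponent k C j →ₗ[k]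
    (C ⧸ coradicalFiltrationPred k C i) ⊗[k] (C ⧸ coradicalFiltrationPred k C j) :=
  TensorProduct.map (grComponent k C i).subtype (grComponent k C j).subtype

theorem grTensorIncl_injective (i j : ℕ) : Function.Injective (grTensorIncl (k := k) (C := C) i j) :=
  TensorProduct.map_injective_of_flat_flat _ _ (Submodule.subtype_injective _)
    (Submodule.subtype_injective _)

theorem mem_range_map_subtype {V W : Type v} [AddCommGroup V] [Module k V] [AddCommGroup W]
    [Module k W] (A : Submodule k V) (B : Submodule k W) (t : V ⊗[k] W)
    (hA : LinearMap.rTensor W A.mkQ t = 0) (hB : LinearMap.lTensor V B.mkQ t = 0) :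
    t ∈ LinearMap.range (TensorProduct.map A.subtype B.subtype) := by
  obtain ⟨s, rfl⟩ := (rTensor_exact W (LinearMap.exact_subtype_mkQ A) A.mkQ_surjective t).1 hA
  have hinj : Function.Injective (LinearMap.rTensor (W ⧸ B) A.subtype) :=
    Module.Flat.rTensor_preserves_injective_linearMap _ A.subtype_injective
  have hs : LinearMap.lTensor A B.mkQ s = 0 := by
    apply hinj
    rw [map_zero, ← hB, ← LinearMap.comp_apply, ← LinearMap.comp_apply,
      LinearMap.rTensor_comp_lTensor, LinearMap.lTensor_comp_rTensor]
  obtain ⟨r, rfl⟩ := (lTensor_exact A (LinearMap.exact_subtype_mkQ B) B.mkQ_surjective s).1 hs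
  exact ⟨r, by rw [← LinearMap.comp_apply, LinearMap.rTensor_comp_lTensor]⟩

theorem quotComul_mem {n i j : ℕ} (h : i + j = n) (y : grComponent k C n) :
    quotComul h y.1 ∈ LinearMap.range (grTensorIncl (k := k) (C := C) i j) := by
  obtain ⟨_, x, hx, rfl⟩ := y
  have hx' : x ∈ coradicalFiltrationPred k C (n + 1) := hx
  apply mem_range_map_subtype
  · have h1 := (mem_wedge_iff _ _ x).1 (coradicalFiltrationPred_add_le (i + 1) j
      ((show n + 1 = i + 1 + j by omega) ▸ hx'))
    let g := (coradicalFiltrationPred k C (i + 1)).liftQ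
      ((grComponent k C i).mkQ ∘ₗ (coradicalFiltrationPred k C i).mkQ)
      (fun c hc => (Submodule.Quotient.mk_eq_zero _).2 (Submodule.mem_map_of_mem hc))
    have hg : g ∘ₗ (coradicalFiltrationPred k C (i + 1)).mkQ =
      (grComponent k C i).mkQ ∘ₗ (coradicalFiltrationPred k C i).mkQ := Submodule.liftQ_mkQ _ _ _
    have h2 := congrArg (LinearMap.rTensor _ g) h1
    rw [map_zero, ← LinearMap.comp_apply, LinearMap.rTensor_comp_map, hg,
      ← LinearMap.rTensor_comp_map] at h2
    exact h2
  · have h1 := (mem_wedge_iff _ _ x).1 (coradicalFiltrationPred_add_le i (j + 1)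
      ((show n + 1 = i + (j + 1) by omega) ▸ hx'))
    let g := (coradicalFiltrationPred k C (j + 1)).liftQ
      ((grComponent k C j).mkQ ∘ₗ (coradicalFiltrationPred k C j).mkQ)
      (fun c hc => (Submodule.Quotient.mk_eq_zero _).2 (Submodule.mem_map_of_mem hc))
    have hg : g ∘ₗ (coradicalFiltrationPred k C (j + 1)).mkQ =
      (grComponent k C j).mkQ ∘ₗ (coradicalFiltrationPred k C j).mkQ := Submodule.liftQ_mkQ _ _ _
    have h2 := congrArg (LinearMap.lTensor _ g) h1
    rw [map_zero, ← LinearMap.comp_apply, LinearMap.lTensor_comp_map, hg,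
      ← LinearMap.lTensor_comp_map] at h2
    exact h2

/-- The component `Cₙ/Cₙ₋₁ → Cᵢ/Cᵢ₋₁ ⊗ Cⱼ/Cⱼ₋₁` of the comultiplication, for `i + j = n`. -/
noncomputable def grComulComponent {n i j : ℕ} (h : i + j = n) :
    grComponent k C n →ₗ[k] grComponent k C i ⊗[k] grComponent k C j :=
  (LinearEquiv.ofInjective _ (grTensorIncl_injective i j)).symm.toLinearMap ∘ₗ
    LinearMap.codRestrict _ (quotComul h ∘ₗ (grComponent k C n).subtype) (quotComul_mem h)

/-- The defining property: `πₙ(c) ↦ (πᵢ ⊗ πⱼ)(Δ c)`. -/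
theorem grTensorIncl_grComulComponent {n i j : ℕ} (h : i + j = n) (y : grComponent k C n) :
    grTensorIncl i j (grComulComponent h y) = quotComul h y.1 := by
  have := LinearEquiv.apply_symm_apply (LinearEquiv.ofInjective _ (grTensorIncl_injective i j))
    (LinearMap.codRestrict _ (quotComul h ∘ₗ (grComponent k C n).subtype) (quotComul_mem h) y)
  exact congrArg Subtype.val this

theorem grTensorIncl_comp_grComulComponent {n i j : ℕ} (h : i + j = n) :
    grTensorIncl i j ∘ₗ grComulComponent (k := k) (C := C) h =
      quotComul h ∘ₗ (grComponent k C n).subtype :=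
  LinearMap.ext (grTensorIncl_grComulComponent h)

theorem quotComul_comp_mkQ {n i j : ℕ} (h : i + j = n) :
    quotComul h ∘ₗ (coradicalFiltrationPred k C n).mkQ =
      TensorProduct.map (coradicalFiltrationPred k C i).mkQ (coradicalFiltrationPred k C j).mkQ ∘ₗ
        Coalgebra.comul :=
  Submodule.liftQ_mkQ _ _ _

theorem quotComul_coassoc {n a b i j l : ℕ} (h₁ : a + l = n) (h₂ : i + j = a) (h₃ : i + b = n)
    (h₄ : j + l = b) (y : C ⧸ coradicalFiltrationPred k C n) :
    TensorProduct.assoc k _ _ _ (LinearMap.rTensor _ (quotComul h₂) (quotComul h₁ y)) =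
      LinearMap.lTensor _ (quotComul h₄) (quotComul h₃ y) := by
  obtain ⟨x, rfl⟩ := Submodule.mkQ_surjective _ y
  rw [← LinearMap.comp_apply (quotComul h₁), ← LinearMap.comp_apply (quotComul h₃),
    quotComul_comp_mkQ, quotComul_comp_mkQ, LinearMap.comp_apply, LinearMap.comp_apply,
    ← LinearMap.comp_apply (LinearMap.rTensor _ _), ← LinearMap.comp_apply (LinearMap.lTensor _ _),
    LinearMap.rTensor_comp_map, LinearMap.lTensor_comp_map, quotComul_comp_mkQ, quotComul_comp_mkQ,
    ← LinearMap.map_comp_rTensor, ← LinearMap.map_comp_lTensor, LinearMap.comp_apply,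
    LinearMap.comp_apply, ← TensorProduct.map_map_assoc, Coalgebra.coassoc_apply]

theorem grComulComponent_coassoc {n a b i j l : ℕ} (h₁ : a + l = n) (h₂ : i + j = a)
    (h₃ : i + b = n) (h₄ : j + l = b) (y : grComponent k C n) :
    TensorProduct.assoc k _ _ _
        (LinearMap.rTensor _ (grComulComponent h₂) (grComulComponent h₁ y)) =
      LinearMap.lTensor _ (grComulComponent h₄) (grComulComponent h₃ y) := by
  have hinj : Function.Injective (TensorProduct.map (grComponent k C i).subtype
      (grTensorIncl (k := k) (C := C) j l)) :=
    TensorProduct.map_injective_of_flat_flat _ _ (Submodule.subtype_injective _)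
      (grTensorIncl_injective j l)
  apply hinj
  have e1 : TensorProduct.map (grTensorIncl i j) (grComponent k C l).subtype ∘ₗ
      LinearMap.rTensor _ (grComulComponent h₂) =
      LinearMap.rTensor _ (quotComul h₂) ∘ₗ grTensorIncl a l := by
    rw [LinearMap.map_comp_rTensor, grTensorIncl_comp_grComulComponent, grTensorIncl,
      LinearMap.rTensor_comp_map]
  have e2 : TensorProduct.map (grComponent k C i).subtype (grTensorIncl j l) ∘ₗ
      LinearMap.lTensor _ (grComulComponent h₄) =
      LinearMap.lTensor _ (quotComul h₄) ∘ₗ grTensorIncl i b := by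
    rw [LinearMap.map_comp_lTensor, grTensorIncl_comp_grComulComponent, grTensorIncl,
      LinearMap.lTensor_comp_map]
  have e1' := LinearMap.congr_fun e1 (grComulComponent h₁ y)
  have e2' := LinearMap.congr_fun e2 (grComulComponent h₃ y)
  simp only [LinearMap.comp_apply, grTensorIncl_grComulComponent] at e1' e2'
  rw [e2', ← quotComul_coassoc h₁ h₂ h₃ h₄, ← e1']
  exact TensorProduct.map_map_assoc _ _ _ _

/-- The counit on `C / Cₙ₋₁`: it is `ε` for `n = 0` and zero in positive degree. -/
noncomputable def quotCounit : (n : ℕ) → C ⧸ coradicalFiltrationPred k C n →ₗ[k] k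
  | 0 => (coradicalFiltrationPred k C 0).liftQ Coalgebra.counit
      (bot_le : (⊥ : Submodule k C) ≤ _)
  | _ + 1 => 0

/-- The part of `Δ` on `Cₙ/Cₙ₋₁` with values in the component of bidegree `(i, j)`, `i + j = n`. -/
noncomputable def Gr.comulPart (n i j : ℕ) : grComponent k C n →ₗ[k] Gr k C ⊗[k] Gr k C :=
  if h : i + j = n then TensorProduct.map (Gr.of k C i) (Gr.of k C j) ∘ₗ grComulComponent h else 0

/-- The graded coalgebra structure: `Δ(πₙ(c)) = ∑_{i+j=n} (πᵢ ⊗ πⱼ)(Δ c)` for `c ∈ Cₙ`, and the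
counit is that of `C` on `C₀` and zero in positive degrees. -/
noncomputable instance Gr.instCoalgebraStruct : CoalgebraStruct k (Gr k C) where
  comul := DirectSum.toModule k ℕ (Gr k C ⊗[k] Gr k C) fun n =>
    ∑ p ∈ Finset.HasAntidiagonal.antidiagonal n, Gr.comulPart n p.1 p.2
  counit := DirectSum.toModule k ℕ k fun n => quotCounit n ∘ₗ (grComponent k C n).subtype

theorem Gr.comulPart_of_add_eq {n i j : ℕ} (h : i + j = n) : Gr.comulPart (k := k) (C := C) n i j =
    TensorProduct.map (Gr.of k C i) (Gr.of k C j) ∘ₗ grComulComponent h := dif_pos h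

theorem Gr.comul_of (n : ℕ) (y : grComponent k C n) : Coalgebra.comul (R := k) (Gr.of k C n y) =
    ∑ p ∈ Finset.HasAntidiagonal.antidiagonal n, Gr.comulPart n p.1 p.2 y := by
  refine (DirectSum.toModule_lof (M := fun n => grComponent k C n) k n y).trans ?_
  rw [LinearMap.sum_apply]

theorem Gr.counit_of (n : ℕ) (y : grComponent k C n) :
    Coalgebra.counit (R := k) (Gr.of k C n y) = quotCounit n y.1 :=
  DirectSum.toModule_lof (M := fun n => grComponent k C n) k n y

theorem Gr.hom_ext {M : Type*} [AddCommGroup M] [Module k M] {f g : Gr k C →ₗ[k] M}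
    (h : ∀ n y, f (Gr.of k C n y) = g (Gr.of k C n y)) : f = g :=
  DirectSum.linearMap_ext k fun n => LinearMap.ext (h n)

theorem quotComul_counit_left (n : ℕ) (y : C ⧸ coradicalFiltrationPred k C n) :
    LinearMap.rTensor _ (quotCounit 0) (quotComul (zero_add n) y) = 1 ⊗ₜ y := by
  obtain ⟨x, rfl⟩ := Submodule.mkQ_surjective _ y
  have e : quotCounit 0 ∘ₗ (coradicalFiltrationPred k C 0).mkQ = Coalgebra.counit :=
    Submodule.liftQ_mkQ _ _ _
  rw [← LinearMap.comp_apply (quotComul _), quotComul_comp_mkQ, LinearMap.comp_apply,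
    ← LinearMap.comp_apply (LinearMap.rTensor _ _), LinearMap.rTensor_comp_map, e,
    ← LinearMap.lTensor_comp_rTensor, LinearMap.comp_apply, Coalgebra.rTensor_counit_comul,
    LinearMap.lTensor_tmul]

theorem quotComul_counit_right (n : ℕ) (y : C ⧸ coradicalFiltrationPred k C n) :
    LinearMap.lTensor _ (quotCounit 0) (quotComul (add_zero n) y) = y ⊗ₜ 1 := by
  obtain ⟨x, rfl⟩ := Submodule.mkQ_surjective _ y
  have e : quotCounit 0 ∘ₗ (coradicalFiltrationPred k C 0).mkQ = Coalgebra.counit :=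
    Submodule.liftQ_mkQ _ _ _
  rw [← LinearMap.comp_apply (quotComul _), quotComul_comp_mkQ, LinearMap.comp_apply,
    ← LinearMap.comp_apply (LinearMap.lTensor _ _), LinearMap.lTensor_comp_map, e,
    ← LinearMap.rTensor_comp_lTensor, LinearMap.comp_apply, Coalgebra.lTensor_counit_comul,
    LinearMap.rTensor_tmul]

theorem Gr.counit_comp_of (n : ℕ) : Coalgebra.counit (R := k) ∘ₗ Gr.of k C n =
    quotCounit n ∘ₗ (grComponent k C n).subtype :=
  LinearMap.ext (Gr.counit_of n)

theorem Gr.comul_comp_of (n : ℕ) : Coalgebra.comul (R := k) ∘ₗ Gr.of k C n =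
    ∑ p ∈ Finset.HasAntidiagonal.antidiagonal n, Gr.comulPart n p.1 p.2 :=
  LinearMap.ext fun y => by rw [LinearMap.sum_apply]; exact Gr.comul_of n y

theorem Gr.coassoc_part {n a b i j l : ℕ} (h₁ : a + l = n) (h₂ : i + j = a)
    (h₃ : i + b = n) (h₄ : j + l = b) (y : grComponent k C n) :
    TensorProduct.assoc k _ _ _ (TensorProduct.map (Gr.comulPart a i j) (Gr.of k C l)
        (grComulComponent h₁ y)) =
      TensorProduct.map (Gr.of k C i) (Gr.comulPart b j l) (grComulComponent h₃ y) := by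
  rw [Gr.comulPart_of_add_eq h₂, Gr.comulPart_of_add_eq h₄, ← LinearMap.map_comp_rTensor,
    ← LinearMap.map_comp_lTensor, LinearMap.comp_apply, LinearMap.comp_apply,
    ← grComulComponent_coassoc h₁ h₂ h₃ h₄, TensorProduct.map_map_assoc]

theorem Gr.rTensor_comul_part {n a l : ℕ} (h : a + l = n) (y : grComponent k C n) :
    LinearMap.rTensor (Gr k C) Coalgebra.comul (Gr.comulPart n a l y) =
      ∑ q ∈ Finset.HasAntidiagonal.antidiagonal a,
        TensorProduct.map (Gr.comulPart a q.1 q.2) (Gr.of k C l) (grComulComponent h y) := by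
  rw [Gr.comulPart_of_add_eq h, ← LinearMap.comp_apply, ← LinearMap.comp_assoc,
    LinearMap.rTensor_comp_map, Gr.comul_comp_of, LinearMap.comp_apply,
    ← TensorProduct.mapBilinear_apply, map_sum, LinearMap.sum_apply, LinearMap.sum_apply]
  rfl

theorem Gr.lTensor_comul_part {n i b : ℕ} (h : i + b = n) (y : grComponent k C n) :
    LinearMap.lTensor (Gr k C) Coalgebra.comul (Gr.comulPart n i b y) =
      ∑ q ∈ Finset.HasAntidiagonal.antidiagonal b,
        TensorProduct.map (Gr.of k C i) (Gr.comulPart b q.1 q.2) (grComulComponent h y) := by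
  rw [Gr.comulPart_of_add_eq h, ← LinearMap.comp_apply, ← LinearMap.comp_assoc,
    LinearMap.lTensor_comp_map, Gr.comul_comp_of, LinearMap.comp_apply,
    ← TensorProduct.mapBilinear_apply, map_sum, LinearMap.sum_apply]
  rfl

theorem Gr.rTensor_counit_part {n i j : ℕ} (h : i + j = n) (hi : i ≠ 0) (y : grComponent k C n) :
    LinearMap.rTensor (Gr k C) Coalgebra.counit (Gr.comulPart n i j y) = 0 := by
  obtain ⟨i, rfl⟩ := Nat.exists_eq_succ_of_ne_zero hi
  have h0 : quotCounit (k := k) (C := C) (i + 1) = 0 := rfl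
  rw [Gr.comulPart_of_add_eq h, ← LinearMap.comp_apply, ← LinearMap.comp_assoc,
    LinearMap.rTensor_comp_map, Gr.counit_comp_of, h0, LinearMap.zero_comp,
    TensorProduct.map_zero_left, LinearMap.zero_comp, LinearMap.zero_apply]

theorem Gr.lTensor_counit_part {n i j : ℕ} (h : i + j = n) (hj : j ≠ 0) (y : grComponent k C n) :
    LinearMap.lTensor (Gr k C) Coalgebra.counit (Gr.comulPart n i j y) = 0 := by
  obtain ⟨j, rfl⟩ := Nat.exists_eq_succ_of_ne_zero hj
  have h0 : quotCounit (k := k) (C := C) (j + 1) = 0 := rfl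
  rw [Gr.comulPart_of_add_eq h, ← LinearMap.comp_apply, ← LinearMap.comp_assoc,
    LinearMap.lTensor_comp_map, Gr.counit_comp_of, h0, LinearMap.zero_comp,
    TensorProduct.map_zero_right, LinearMap.zero_comp, LinearMap.zero_apply]

theorem Gr.rTensor_counit_part_zero (n : ℕ) (y : grComponent k C n) :
    LinearMap.rTensor (Gr k C) Coalgebra.counit (Gr.comulPart n 0 n y) = 1 ⊗ₜ Gr.of k C n y := by
  have e : LinearMap.rTensor (grComponent k C n)
      (quotCounit 0 ∘ₗ (grComponent k C 0).subtype) (grComulComponent (zero_add n) y) =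
      1 ⊗ₜ y := by
    have hinj : Function.Injective (LinearMap.lTensor k (grComponent k C n).subtype) :=
      Module.Flat.lTensor_preserves_injective_linearMap _ (Submodule.subtype_injective _)
    apply hinj
    rw [LinearMap.lTensor_tmul, ← LinearMap.comp_apply, LinearMap.lTensor_comp_rTensor]
    refine Eq.trans ?_ (quotComul_counit_left n y.1)
    rw [← grTensorIncl_grComulComponent, grTensorIncl,
      ← LinearMap.comp_apply (LinearMap.rTensor _ _), LinearMap.rTensor_comp_map]
  rw [Gr.comulPart_of_add_eq (zero_add n), ← LinearMap.comp_apply, ← LinearMap.comp_assoc,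
    LinearMap.rTensor_comp_map, Gr.counit_comp_of, ← LinearMap.lTensor_comp_rTensor,
    LinearMap.comp_apply, LinearMap.comp_apply, e, LinearMap.lTensor_tmul]

theorem Gr.lTensor_counit_part_zero (n : ℕ) (y : grComponent k C n) :
    LinearMap.lTensor (Gr k C) Coalgebra.counit (Gr.comulPart n n 0 y) = Gr.of k C n y ⊗ₜ 1 := by
  have e : LinearMap.lTensor (grComponent k C n)
      (quotCounit 0 ∘ₗ (grComponent k C 0).subtype) (grComulComponent (add_zero n) y) =
      y ⊗ₜ 1 := by
    have hinj : Function.Injective (LinearMap.rTensor k (grComponent k C n).subtype) :=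
      Module.Flat.rTensor_preserves_injective_linearMap _ (Submodule.subtype_injective _)
    apply hinj
    rw [LinearMap.rTensor_tmul, ← LinearMap.comp_apply, LinearMap.rTensor_comp_lTensor]
    refine Eq.trans ?_ (quotComul_counit_right n y.1)
    rw [← grTensorIncl_grComulComponent, grTensorIncl,
      ← LinearMap.comp_apply (LinearMap.lTensor _ _), LinearMap.lTensor_comp_map]
  rw [Gr.comulPart_of_add_eq (add_zero n), ← LinearMap.comp_apply, ← LinearMap.comp_assoc,
    LinearMap.lTensor_comp_map, Gr.counit_comp_of, ← LinearMap.rTensor_comp_lTensor,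
    LinearMap.comp_apply, LinearMap.comp_apply, e, LinearMap.rTensor_tmul]

noncomputable instance Gr.instCoalgebra : Coalgebra k (Gr k C) where
  coassoc := Gr.hom_ext fun n y => by
    simp only [LinearMap.comp_apply, LinearEquiv.coe_coe, Gr.comul_of, map_sum]
    let D : (i j : ℕ) → grComponent k C i ⊗[k] grComponent k C j :=
      fun i j => if h : i + j = n then grComulComponent h y else 0
    have hD : ∀ {i j : ℕ} (h : i + j = n), D i j = grComulComponent h y := fun h => dif_pos h
    have hl : ∀ p ∈ Finset.HasAntidiagonal.antidiagonal n,
        TensorProduct.assoc k _ _ _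
          (LinearMap.rTensor (Gr k C) Coalgebra.comul (Gr.comulPart n p.1 p.2 y)) =
        ∑ q ∈ Finset.HasAntidiagonal.antidiagonal p.1, TensorProduct.assoc k _ _ _
          (TensorProduct.map (Gr.comulPart p.1 q.1 q.2) (Gr.of k C p.2) (D p.1 p.2)) := by
      intro p hp
      have h := Finset.HasAntidiagonal.mem_antidiagonal.1 hp
      rw [Gr.rTensor_comul_part h y, map_sum, hD h]
    have hr : ∀ p ∈ Finset.HasAntidiagonal.antidiagonal n,
        LinearMap.lTensor (Gr k C) Coalgebra.comul (Gr.comulPart n p.1 p.2 y) =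
        ∑ q ∈ Finset.HasAntidiagonal.antidiagonal p.2,
          TensorProduct.map (Gr.of k C p.1) (Gr.comulPart p.2 q.1 q.2) (D p.1 p.2) := by
      intro p hp
      have h := Finset.HasAntidiagonal.mem_antidiagonal.1 hp
      rw [Gr.lTensor_comul_part h y, hD h]
    rw [Finset.sum_congr rfl hl, Finset.sum_congr rfl hr, Finset.sum_sigma', Finset.sum_sigma']
    refine Finset.sum_bij' (fun x _ => ⟨(x.2.1, x.2.2 + x.1.2), (x.2.2, x.1.2)⟩)
      (fun x _ => ⟨(x.1.1 + x.2.1, x.2.2), (x.1.1, x.2.1)⟩) ?_ ?_ ?_ ?_ ?_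
    · rintro ⟨⟨a, l⟩, ⟨i, j⟩⟩ h
      simp only [Finset.mem_sigma, Finset.HasAntidiagonal.mem_antidiagonal] at h ⊢
      exact ⟨by omega, trivial⟩
    · rintro ⟨⟨i, b⟩, ⟨j, l⟩⟩ h
      simp only [Finset.mem_sigma, Finset.HasAntidiagonal.mem_antidiagonal] at h ⊢
      exact ⟨by omega, trivial⟩
    · rintro ⟨⟨a, l⟩, ⟨i, j⟩⟩ h
      simp only [Finset.mem_sigma, Finset.HasAntidiagonal.mem_antidiagonal] at h
      obtain ⟨rfl, rfl⟩ := h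
      rfl
    · rintro ⟨⟨i, b⟩, ⟨j, l⟩⟩ h
      simp only [Finset.mem_sigma, Finset.HasAntidiagonal.mem_antidiagonal] at h
      obtain ⟨rfl, rfl⟩ := h
      rfl
    · rintro ⟨⟨a, l⟩, ⟨i, j⟩⟩ h
      simp only [Finset.mem_sigma, Finset.HasAntidiagonal.mem_antidiagonal] at h
      have h3 : i + (j + l) = n := by omega
      rw [hD h.1, hD h3]
      exact Gr.coassoc_part h.1 h.2 h3 rfl y
  rTensor_counit_comp_comul := Gr.hom_ext fun n y => by
    simp only [LinearMap.comp_apply, Gr.comul_of, map_sum]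
    rw [Finset.sum_eq_single (0, n)]
    · exact Gr.rTensor_counit_part_zero n y
    · rintro ⟨i, j⟩ hp hne
      have hp' := Finset.HasAntidiagonal.mem_antidiagonal.1 hp
      refine Gr.rTensor_counit_part hp' (fun h0 => hne ?_) y
      simp only at hp' h0
      rw [Prod.mk.injEq]; omega
    · intro h
      exact absurd (Finset.HasAntidiagonal.mem_antidiagonal.2 (zero_add n)) h
  lTensor_counit_comp_comul := Gr.hom_ext fun n y => by
    simp only [LinearMap.comp_apply, Gr.comul_of, map_sum]
    rw [Finset.sum_eq_single (n, 0)]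
    · exact Gr.lTensor_counit_part_zero n y
    · rintro ⟨i, j⟩ hp hne
      have hp' := Finset.HasAntidiagonal.mem_antidiagonal.1 hp
      refine Gr.lTensor_counit_part hp' (fun h0 => hne ?_) y
      simp only at hp' h0
      rw [Prod.mk.injEq]; omega
    · intro h
      exact absurd (Finset.HasAntidiagonal.mem_antidiagonal.2 (add_zero n)) h

end Graded

/-! ### Right comodules and semiperfect coalgebras -/

section Comodule

/-- A right comodule `M` over a coalgebra `C`. -/
class RightComodule (k : Type u) (C : Type v) [Field k] [AddCommGroup C] [Module k C]
    [Coalgebra k C] (M : Type v) [AddCommGroup M] [Module k M] where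
  /-- the coaction `ρ : M → M ⊗ C` -/
  coact : M →ₗ[k] M ⊗[k] C
  coassoc : TensorProduct.assoc k M C C ∘ₗ LinearMap.rTensor C coact ∘ₗ coact =
    LinearMap.lTensor M Coalgebra.comul ∘ₗ coact
  counit : TensorProduct.rid k M ∘ₗ LinearMap.lTensor M Coalgebra.counit ∘ₗ coact = LinearMap.id

variable (k : Type u) (C : Type v) [Field k] [AddCommGroup C] [Module k C] [Coalgebra k C]

/-- A subspace `N` of a right comodule is a subcomodule if `ρ(N) ⊆ N ⊗ C`. -/
def IsSubcomodule {M : Type v} [AddCommGroup M] [Module k M] [RightComodule k C M]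
    (N : Submodule k M) : Prop :=
  ∀ x ∈ N, RightComodule.coact (k := k) (C := C) x ∈ LinearMap.range (LinearMap.rTensor C N.subtype)

/-- A linear map of right comodules is colinear if it commutes with the coactions. -/
def IsComoduleHom {M N : Type v} [AddCommGroup M] [Module k M] [RightComodule k C M]
    [AddCommGroup N] [Module k N] [RightComodule k C N] (f : M →ₗ[k] N) : Prop :=
  RightComodule.coact (k := k) (C := C) ∘ₗ f = LinearMap.rTensor C f ∘ₗ RightComodule.coact

/-- A simple right comodule: nonzero, with no subcomodules other than `0` and itself. -/
def IsSimpleComodule (S : Type v) [AddCommGroup S] [Module k S] [RightComodule k C S] : Prop :=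
  Nontrivial S ∧ ∀ N : Submodule k S, IsSubcomodule k C N → N = ⊥ ∨ N = ⊤

/-- An injective right comodule: every colinear map into it extends along every injective colinear
map. -/
def IsInjectiveComodule (E : Type v) [AddCommGroup E] [Module k E] [RightComodule k C E] : Prop :=
  ∀ (X Y : Type v) [AddCommGroup X] [Module k X] [RightComodule k C X]
    [AddCommGroup Y] [Module k Y] [RightComodule k C Y] (i : X →ₗ[k] Y) (f : X →ₗ[k] E),
    IsComoduleHom k C i → Function.Injective i → IsComoduleHom k C f →
      ∃ g : Y →ₗ[k] E, IsComoduleHom k C g ∧ g ∘ₗ i = f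

/-- `i : M → E` is an injective envelope of the right comodule `M`: it is an injective colinear map
into an injective comodule, and every nonzero subcomodule of `E` meets the image of `i`. -/
def IsInjectiveEnvelope {M E : Type v} [AddCommGroup M] [Module k M] [RightComodule k C M]
    [AddCommGroup E] [Module k E] [RightComodule k C E] (i : M →ₗ[k] E) : Prop :=
  IsComoduleHom k C i ∧ Function.Injective i ∧ IsInjectiveComodule k C E ∧
    ∀ N : Submodule k E, IsSubcomodule k C N → N ≠ ⊥ → N ⊓ LinearMap.range i ≠ ⊥

/-- A coalgebra is left semiperfect if every injective envelope of a simple right comodule is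
finite-dimensional. -/
def IsLeftSemiperfect : Prop :=
  ∀ (S E : Type v) [AddCommGroup S] [Module k S] [RightComodule k C S]
    [AddCommGroup E] [Module k E] [RightComodule k C E] (i : S →ₗ[k] E),
    IsSimpleComodule k C S → IsInjectiveEnvelope k C i → FiniteDimensional k E

end Comodule

/-! Left semiperfectness is equivalent to a condition that only sees the layers of the coradical
filtration (`IsLoewyFinite`): for each simple subcoalgebra `D`, the spaces `(D ∧ Cₙ₋₁)/Cₙ₋₁` are
finite-dimensional and vanish for large `n`. Such a space is the part of `Cₙ/Cₙ₋₁` whose left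
coefficients in `C₀` lie in `D`, so it can be read off from `gr C`.

Criterion implies semiperfect (`IsLoewyFinite.isLeftSemiperfect`). An injective envelope `E` of a
simple comodule embeds in `C` as a right coideal whose intersection with `C₀` lies in one simple
`D`. Then `E ∩ Cₙ ⊆ D ∧ Cₙ₋₁`, so the layers of `E` are finite-dimensional and almost all zero. The
filtration is exhaustive, hence `E` is finite-dimensional.

Semiperfect implies criterion (`IsLeftSemiperfect.isLoewyFinite`). A minimal right coideal has an
injective envelope inside `C` that is the image of some `c ↦ e(c₁)c₂`. Combining finitely many such
functionals gives an `e` that agrees with `ε` on `D` and acts with finite rank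
(`IsLeftSemiperfect.exists_functional`). As `ε - e` kills `D`, it sends `D ∧ Cₙ₋₁` into `Cₙ₋₁`;
modulo `Cₙ₋₁` everything is thus represented in one finite-dimensional space.

Transfer. Because `Cᵢ₋₁ ∧ Cⱼ₋₁ = Cᵢ₊ⱼ₋₁`, the coradical filtration of `gr C` is its degree
filtration (`Gr.coradicalFiltrationPred_eq`), and the simple subcoalgebras of `gr C` are those of
`C₀` placed in degree zero. The component of `Δ` in bidegree `(0, n)` then identifies the layers
attached to `D` on both sides (`Gr.map_proj_wedge`). -/

/-! ### Slicing tensors by functionals -/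

section Slice

variable {k : Type u} [Field k] {V W V' W' : Type*} [AddCommGroup V] [Module k V]
  [AddCommGroup W] [Module k W] [AddCommGroup V'] [Module k V'] [AddCommGroup W'] [Module k W']

/-- `f ⊗ id`, with values in `W`. -/
noncomputable def sliceLeft (W : Type*) [AddCommGroup W] [Module k W] (f : V →ₗ[k] k) :
    V ⊗[k] W →ₗ[k] W :=
  TensorProduct.lid k W ∘ₗ LinearMap.rTensor W f

/-- `id ⊗ g`, with values in `V`. -/
noncomputable def sliceRight (V : Type*) [AddCommGroup V] [Module k V] (g : W →ₗ[k] k) :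
    V ⊗[k] W →ₗ[k] V :=
  TensorProduct.rid k V ∘ₗ LinearMap.lTensor V g

@[simp] theorem sliceLeft_tmul (f : V →ₗ[k] k) (x : V) (y : W) :
    sliceLeft W f (x ⊗ₜ y) = f x • y := by simp [sliceLeft]

@[simp] theorem sliceRight_tmul (g : W →ₗ[k] k) (x : V) (y : W) :
    sliceRight V g (x ⊗ₜ y) = g y • x := by simp [sliceRight]

theorem sliceLeft_map (f : V' →ₗ[k] k) (a : V →ₗ[k] V') (b : W →ₗ[k] W') (t : V ⊗[k] W) :
    sliceLeft W' f (TensorProduct.map a b t) = b (sliceLeft W (f ∘ₗ a) t) := by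
  induction t with
  | zero => simp
  | add x y hx hy => simp [hx, hy]
  | tmul x y => simp

theorem sliceRight_map (g : W' →ₗ[k] k) (a : V →ₗ[k] V') (b : W →ₗ[k] W') (t : V ⊗[k] W) :
    sliceRight V' g (TensorProduct.map a b t) = a (sliceRight V (g ∘ₗ b) t) := by
  induction t with
  | zero => simp
  | add x y hx hy => simp [hx, hy]
  | tmul x y => simp

theorem sliceLeft_rTensor (f : V' →ₗ[k] k) (a : V →ₗ[k] V') (t : V ⊗[k] W) :
    sliceLeft W f (LinearMap.rTensor W a t) = sliceLeft W (f ∘ₗ a) t :=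
  sliceLeft_map f a LinearMap.id t

theorem sliceRight_rTensor (g : W →ₗ[k] k) (a : V →ₗ[k] V') (t : V ⊗[k] W) :
    sliceRight V' g (LinearMap.rTensor W a t) = a (sliceRight V g t) :=
  sliceRight_map g a LinearMap.id t

theorem sliceLeft_add (f g : V →ₗ[k] k) : sliceLeft W (f + g) = sliceLeft W f + sliceLeft W g := by
  ext; simp [add_smul]

theorem sliceLeft_sub (f g : V →ₗ[k] k) : sliceLeft W (f - g) = sliceLeft W f - sliceLeft W g := by
  ext; simp [sub_smul]

/-- Slices by the coordinate functionals of a basis of `V` are the coordinates of `t`. -/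
theorem eq_zero_of_sliceLeft (t : V ⊗[k] W) (h : ∀ f : V →ₗ[k] k, sliceLeft W f t = 0) : t = 0 := by
  classical
  let b := Module.Basis.ofVectorSpace k V
  apply (TensorProduct.equivFinsuppOfBasisLeft (N := W) b).injective
  have e : ∀ (z : V ⊗[k] W) i, TensorProduct.equivFinsuppOfBasisLeft b z i =
      sliceLeft W (b.coord i) z := fun z i => by
    induction z with
    | zero => simp
    | add x y hx hy => simp [hx, hy]
    | tmul x y => simp
  rw [map_zero]
  ext i
  rw [e, h, Finsupp.zero_apply]

theorem eq_zero_of_sliceRight (t : V ⊗[k] W) (h : ∀ g : W →ₗ[k] k, sliceRight V g t = 0) :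
    t = 0 := by
  apply (TensorProduct.comm k V W).injective
  rw [map_zero]
  refine eq_zero_of_sliceLeft _ fun f => ?_
  rw [← h f]
  generalize t = t
  induction t with
  | zero => simp
  | add x y hx hy => simp [hx, hy]
  | tmul x y => simp

theorem mem_range_rTensor_iff (N : Submodule k V) (t : V ⊗[k] W) :
    t ∈ LinearMap.range (LinearMap.rTensor W N.subtype) ↔
      ∀ g : W →ₗ[k] k, sliceRight V g t ∈ N := by
  constructor
  · rintro ⟨s, rfl⟩ g
    rw [sliceRight_rTensor]
    exact Subtype.prop _
  · intro h
    refine (rTensor_exact W (LinearMap.exact_subtype_mkQ N) N.mkQ_surjective t).1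
      (eq_zero_of_sliceRight _ fun g => ?_)
    rw [sliceRight_rTensor]
    exact (Submodule.Quotient.mk_eq_zero N).2 (h g)

/-- Functionals vanishing on `X` are the functionals on `V ⧸ X`, and slices detect zero in the
tensor product of the quotients. -/
theorem mkQ_map_eq_zero_iff_left (X : Submodule k V) (Y : Submodule k W) (t : V ⊗[k] W) :
    TensorProduct.map X.mkQ Y.mkQ t = 0 ↔
      ∀ f : V →ₗ[k] k, (∀ x ∈ X, f x = 0) → sliceLeft W f t ∈ Y := by
  constructor
  · intro h f hf
    have hle : X ≤ LinearMap.ker f := fun a ha => hf a ha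
    have := sliceLeft_map (X.liftQ f hle) X.mkQ Y.mkQ t
    rw [h, map_zero, Submodule.liftQ_mkQ] at this
    exact (Submodule.Quotient.mk_eq_zero Y).1 this.symm
  · intro h
    refine eq_zero_of_sliceLeft _ fun f => ?_
    rw [sliceLeft_map]
    refine (Submodule.Quotient.mk_eq_zero Y).2 (h _ fun x hx => ?_)
    rw [LinearMap.comp_apply, Submodule.mkQ_apply, (Submodule.Quotient.mk_eq_zero X).2 hx, map_zero]

theorem mkQ_map_eq_zero_iff_right (X : Submodule k V) (Y : Submodule k W) (t : V ⊗[k] W) :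
    TensorProduct.map X.mkQ Y.mkQ t = 0 ↔
      ∀ g : W →ₗ[k] k, (∀ y ∈ Y, g y = 0) → sliceRight V g t ∈ X := by
  constructor
  · intro h g hg
    have hle : Y ≤ LinearMap.ker g := fun a ha => hg a ha
    have := sliceRight_map (Y.liftQ g hle) X.mkQ Y.mkQ t
    rw [h, map_zero, Submodule.liftQ_mkQ] at this
    exact (Submodule.Quotient.mk_eq_zero X).1 this.symm
  · intro h
    refine eq_zero_of_sliceRight _ fun g => ?_
    rw [sliceRight_map]
    refine (Submodule.Quotient.mk_eq_zero X).2 (h _ fun y hy => ?_)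
    rw [LinearMap.comp_apply, Submodule.mkQ_apply, (Submodule.Quotient.mk_eq_zero Y).2 hy, map_zero]

theorem mem_of_forall_functional (X : Submodule k V) (x : V)
    (h : ∀ f : V →ₗ[k] k, (∀ a ∈ X, f a = 0) → f x = 0) : x ∈ X := by
  by_contra hx
  obtain ⟨f, hfx, hf⟩ := Submodule.exists_le_ker_of_notMem hx
  exact hfx (h f fun a ha => hf ha)

/-- A functional can be prescribed on a subspace, and required to vanish on a disjoint one. -/
theorem exists_functional_of_disjoint {X Y : Submodule k V} (h : Y ⊓ X = ⊥) (φ : V →ₗ[k] k) :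
    ∃ e : V →ₗ[k] k, (∀ x ∈ X, e x = φ x) ∧ ∀ y ∈ Y, e y = 0 := by
  have hinj : LinearMap.ker (Y.mkQ ∘ₗ X.subtype) = ⊥ := by
    refine (Submodule.eq_bot_iff _).2 fun x hx => Subtype.ext ?_
    have hx' : (x : V) ∈ Y := (Submodule.Quotient.mk_eq_zero Y).1 hx
    exact (Submodule.eq_bot_iff _).1 h _ ⟨hx', x.2⟩
  obtain ⟨l, hl⟩ := LinearMap.exists_leftInverse_of_injective _ hinj
  refine ⟨φ ∘ₗ X.subtype ∘ₗ l ∘ₗ Y.mkQ, fun x hx => ?_, fun y hy => ?_⟩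
  · have := LinearMap.congr_fun hl ⟨x, hx⟩
    simp only [LinearMap.comp_apply, Submodule.subtype_apply, LinearMap.id_apply] at this ⊢
    rw [this]
  · simp [(Submodule.Quotient.mk_eq_zero Y).2 hy]

/-- Zorn's lemma for subspaces which are disjoint from `D` and satisfy a property that is closed
under sums. -/
theorem exists_maximal_disjoint (P : Submodule k V → Prop)
    (hP : ∀ S : Set (Submodule k V), (∀ X ∈ S, P X) → P (sSup S)) (D : Submodule k V) :
    ∃ Y, P Y ∧ Y ⊓ D = ⊥ ∧ ∀ Z, P Z → Y ≤ Z → Z ⊓ D = ⊥ → Z ≤ Y := by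
  obtain ⟨Y, hY⟩ := zorn_le₀ {Y : Submodule k V | P Y ∧ Y ⊓ D = ⊥} (by
    intro c hc hchain
    refine ⟨sSup c, ⟨hP c fun X hX => (hc hX).1, ?_⟩, fun X hX => le_sSup hX⟩
    rcases c.eq_empty_or_nonempty with rfl | hne
    · simp
    · refine (Submodule.eq_bot_iff _).2 fun x hx => ?_
      obtain ⟨X, hX, hxX⟩ := (Submodule.mem_sSup_of_directed hne hchain.directedOn).1 hx.1
      exact (Submodule.eq_bot_iff _).1 (hc hX).2 x ⟨hxX, hx.2⟩)
  exact ⟨Y, hY.prop.1, hY.prop.2, fun Z hZ hYZ hZD => hY.le_of_ge ⟨hZ, hZD⟩ hYZ⟩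

end Slice

/-! ### Comodules through the action of the dual algebra -/

section Action

variable {k : Type u} {C : Type v} [Field k] [AddCommGroup C] [Module k C] [Coalgebra k C]
  {M : Type v} [AddCommGroup M] [Module k M] [RightComodule k C M]

variable (M) in
/-- The left action `m ↦ m₀ g(m₁)` of a functional on a right comodule. -/
noncomputable def coactBy (g : C →ₗ[k] k) : M →ₗ[k] M :=
  sliceRight M g ∘ₗ RightComodule.coact

variable (C) in
/-- The coefficient map `m ↦ f(m₀) m₁` of a functional `f` on a right comodule. -/
noncomputable def coeffMap (f : M →ₗ[k] k) : M →ₗ[k] C :=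
  sliceLeft C f ∘ₗ RightComodule.coact

/-- Subcomodules become subspaces stable under a family of operators, which makes sums,
intersections, images and preimages immediate. -/
theorem isSubcomodule_iff (N : Submodule k M) :
    IsSubcomodule k C N ↔ ∀ (g : C →ₗ[k] k), ∀ x ∈ N, coactBy M g x ∈ N :=
  ⟨fun h g x hx => (mem_range_rTensor_iff N _).1 (h x hx) g,
    fun h x hx => (mem_range_rTensor_iff N _).2 fun g => h g x hx⟩

noncomputable instance Coalgebra.selfRightComodule : RightComodule k C C where
  coact := Coalgebra.comul
  coassoc := Coalgebra.coassoc
  counit := by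
    ext x
    simp

/-- Coassociativity read through functionals: the one on the right is the convolution product of `f`
and `g`, so `M` is a left module over the dual algebra. -/
theorem coactBy_coactBy (f g : C →ₗ[k] k) (m : M) :
    coactBy M f (coactBy M g m) =
      coactBy M (LinearMap.mul' k k ∘ₗ TensorProduct.map f g ∘ₗ Coalgebra.comul) m := by
  have h := LinearMap.congr_fun (RightComodule.coassoc (k := k) (C := C) (M := M)) m
  simp only [LinearMap.comp_apply, LinearEquiv.coe_coe] at h
  have e1 : ∀ t : M ⊗[k] C, sliceRight M (LinearMap.mul' k k ∘ₗ TensorProduct.map f g ∘ₗ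
      Coalgebra.comul) t = sliceRight M (LinearMap.mul' k k ∘ₗ TensorProduct.map f g)
        (LinearMap.lTensor M Coalgebra.comul t) := fun t => by
    rw [← LinearMap.comp_assoc]
    exact (sliceRight_map (LinearMap.mul' k k ∘ₗ TensorProduct.map f g) LinearMap.id
      Coalgebra.comul t).symm
  have e2 : ∀ s : (M ⊗[k] C) ⊗[k] C, sliceRight M (LinearMap.mul' k k ∘ₗ TensorProduct.map f g)
      (TensorProduct.assoc k M C C s) = sliceRight M f (sliceRight (M ⊗[k] C) g s) := fun s => by
    induction s with
    | zero => simp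
    | add x y hx hy => simp [hx, hy]
    | tmul x y =>
      induction x with
      | zero => simp
      | add a b ha hb => simp [TensorProduct.add_tmul, ha, hb]
      | tmul a b => simp [smul_smul, mul_comm]
  have e3 := sliceRight_rTensor (V' := M ⊗[k] C) g (RightComodule.coact (k := k) (C := C))
    (RightComodule.coact (k := k) (C := C) m)
  simp only [coactBy, LinearMap.comp_apply]
  rw [e1, ← h, e2, e3]

theorem coactBy_counit (m : M) : coactBy M (Coalgebra.counit (R := k) (A := C)) m = m :=
  LinearMap.congr_fun (RightComodule.counit (k := k) (C := C) (M := M)) m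

theorem counit_coeffMap (f : M →ₗ[k] k) (m : M) :
    Coalgebra.counit (R := k) (coeffMap C f m) = f m := by
  have h := congrArg f (coactBy_counit (k := k) (C := C) m)
  rw [← h]
  simp only [coactBy, coeffMap, LinearMap.comp_apply]
  generalize RightComodule.coact (k := k) (C := C) m = t
  induction t with
  | zero => simp
  | add x y hx hy => simp [hx, hy]
  | tmul x y => simp [mul_comm]

/-- Coassociativity again. Together with `counit_coeffMap` and `IsComoduleHom.eq_coeffMap` it shows
that colinear maps `M → C` are the same as functionals on `M`, that is, `C` is cofree; all colinear
maps into `C` are built this way. -/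
theorem isComoduleHom_coeffMap (f : M →ₗ[k] k) : IsComoduleHom k C (coeffMap C f) := by
  ext m
  have h := LinearMap.congr_fun (RightComodule.coassoc (k := k) (C := C) (M := M)) m
  simp only [LinearMap.comp_apply, LinearEquiv.coe_coe] at h
  have e1 : ∀ t : M ⊗[k] C, Coalgebra.comul (sliceLeft C f t) =
      sliceLeft (C ⊗[k] C) f (LinearMap.lTensor M Coalgebra.comul t) := fun t =>
    (sliceLeft_map f LinearMap.id Coalgebra.comul t).symm
  have e2 : ∀ s : (M ⊗[k] C) ⊗[k] C, sliceLeft (C ⊗[k] C) f (TensorProduct.assoc k M C C s) =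
      LinearMap.rTensor C (sliceLeft C f) s := fun s => by
    induction s with
    | zero => simp
    | add x y hx hy => simp [hx, hy]
    | tmul x y =>
      induction x with
      | zero => simp
      | add a b ha hb => simp [TensorProduct.add_tmul, ha, hb]
      | tmul a b => simp [TensorProduct.smul_tmul']
  change Coalgebra.comul (sliceLeft C f _) = LinearMap.rTensor C (coeffMap C f) _
  rw [e1, ← h, e2, coeffMap, LinearMap.rTensor_comp]
  rfl

theorem IsComoduleHom.map_coactBy {N : Type v} [AddCommGroup N] [Module k N] [RightComodule k C N]
    {h : M →ₗ[k] N} (hh : IsComoduleHom k C h) (g : C →ₗ[k] k) (m : M) :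
    h (coactBy M g m) = coactBy N g (h m) := by
  have := LinearMap.congr_fun hh m
  simp only [LinearMap.comp_apply] at this
  simp only [coactBy, LinearMap.comp_apply]
  rw [this, sliceRight_rTensor]

theorem coeffMap_comp {N : Type v} [AddCommGroup N] [Module k N] [RightComodule k C N]
    {h : M →ₗ[k] N} (hh : IsComoduleHom k C h) (f : N →ₗ[k] k) :
    coeffMap C f ∘ₗ h = coeffMap C (f ∘ₗ h) := by
  ext m
  have := LinearMap.congr_fun hh m
  simp only [LinearMap.comp_apply] at this
  simp only [coeffMap, LinearMap.comp_apply]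
  rw [this, sliceLeft_rTensor]

theorem coeffMap_counit (c : C) : coeffMap C (Coalgebra.counit (R := k) (A := C)) c = c := by
  change TensorProduct.lid k C (LinearMap.rTensor C Coalgebra.counit (Coalgebra.comul c)) = c
  rw [Coalgebra.rTensor_counit_comul]
  simp

theorem IsComoduleHom.eq_coeffMap {h : M →ₗ[k] C} (hh : IsComoduleHom k C h) :
    h = coeffMap C (Coalgebra.counit ∘ₗ h) := by
  rw [← coeffMap_comp hh]
  ext m
  exact (coeffMap_counit _).symm

theorem coeffMap_eq_zero_iff (f : M →ₗ[k] k) : coeffMap C f = 0 ↔ f = 0 := by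
  constructor
  · intro h
    ext m
    rw [← counit_coeffMap (C := C), h]
    simp
  · rintro rfl
    ext
    simp [coeffMap, sliceLeft]

theorem coeffMap_add (f g : M →ₗ[k] k) : coeffMap C (f + g) = coeffMap C f + coeffMap C g := by
  rw [coeffMap, sliceLeft_add]; rfl

theorem coeffMap_sub (f g : M →ₗ[k] k) : coeffMap C (f - g) = coeffMap C f - coeffMap C g := by
  rw [coeffMap, sliceLeft_sub]; rfl

/-- The right action commutes with the left action. -/
theorem coeffMap_coactBy (f : M →ₗ[k] k) (g : C →ₗ[k] k) (m : M) :
    coeffMap C f (coactBy M g m) = coactBy C g (coeffMap C f m) :=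
  (isComoduleHom_coeffMap f).map_coactBy g m

theorem coeffMap_coeffMap (e : C →ₗ[k] k) (f : M →ₗ[k] k) (m : M) :
    coeffMap C e (coeffMap C f m) = coeffMap C (e ∘ₗ coeffMap C f) m :=
  LinearMap.congr_fun (coeffMap_comp (isComoduleHom_coeffMap f) e) m

theorem counit_coactBy (g : C →ₗ[k] k) (c : C) :
    Coalgebra.counit (R := k) (coactBy C g c) = g c := by
  have h := congrArg g (coeffMap_counit (k := k) c)
  rw [← h]
  simp only [coactBy, coeffMap, LinearMap.comp_apply]
  generalize RightComodule.coact (k := k) (C := C) c = t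
  induction t with
  | zero => simp
  | add x y hx hy => simp [hx, hy]
  | tmul x y => simp [mul_comm]

end Action

/-! ### Subcomodules, subcoalgebras and wedges through the two actions -/

section Lattice

variable {k : Type u} {C : Type v} [Field k] [AddCommGroup C] [Module k C] [Coalgebra k C]
  {M N : Type v} [AddCommGroup M] [Module k M] [RightComodule k C M]
  [AddCommGroup N] [Module k N] [RightComodule k C N]

theorem IsSubcomodule.inf {X Y : Submodule k M} (hX : IsSubcomodule k C X)
    (hY : IsSubcomodule k C Y) : IsSubcomodule k C (X ⊓ Y) := by
  rw [isSubcomodule_iff] at *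
  exact fun g x hx => ⟨hX g x hx.1, hY g x hx.2⟩

theorem Submodule.mem_sSup_of_forall_map {S : Set (Submodule k M)} (h : M →ₗ[k] M)
    (hS : ∀ X ∈ S, ∀ x ∈ X, h x ∈ X) : ∀ x ∈ sSup S, h x ∈ sSup S := by
  have : sSup S ≤ (sSup S).comap h :=
    sSup_le fun X hX x hx => (le_sSup hX : X ≤ sSup S) (hS X hX x hx)
  exact this

theorem IsSubcomodule.sSup {S : Set (Submodule k M)} (hS : ∀ X ∈ S, IsSubcomodule k C X) :
    IsSubcomodule k C (sSup S) := by
  rw [isSubcomodule_iff]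
  exact fun g => Submodule.mem_sSup_of_forall_map _ fun X hX =>
    (isSubcomodule_iff X).1 (hS X hX) g

theorem IsSubcomodule.sup {X Y : Submodule k M} (hX : IsSubcomodule k C X)
    (hY : IsSubcomodule k C Y) : IsSubcomodule k C (X ⊔ Y) := by
  rw [← sSup_pair]
  refine IsSubcomodule.sSup ?_
  rintro _ (rfl | rfl)
  exacts [hX, hY]

theorem isSubcomodule_bot : IsSubcomodule k C (⊥ : Submodule k M) :=
  (isSubcomodule_iff _).2 fun g x hx => by
    rw [(Submodule.mem_bot k).1 hx, map_zero]; exact zero_mem _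

theorem isSubcomodule_top : IsSubcomodule k C (⊤ : Submodule k M) :=
  (isSubcomodule_iff _).2 fun _ _ _ => trivial

theorem IsSubcomodule.map {h : M →ₗ[k] N} (hh : IsComoduleHom k C h) {X : Submodule k M}
    (hX : IsSubcomodule k C X) : IsSubcomodule k C (X.map h) := by
  rw [isSubcomodule_iff] at *
  rintro g _ ⟨x, hx, rfl⟩
  exact ⟨_, hX g x hx, hh.map_coactBy g x⟩

theorem IsSubcomodule.comap {h : M →ₗ[k] N} (hh : IsComoduleHom k C h) {X : Submodule k N}
    (hX : IsSubcomodule k C X) : IsSubcomodule k C (X.comap h) := by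
  rw [isSubcomodule_iff] at *
  intro g x hx
  rw [Submodule.mem_comap, hh.map_coactBy]
  exact hX g _ hx

theorem IsSubcomodule.range {h : M →ₗ[k] N} (hh : IsComoduleHom k C h) :
    IsSubcomodule k C (LinearMap.range h) := by
  rw [← Submodule.map_top]
  exact isSubcomodule_top.map hh

theorem IsSubcomodule.ker {h : M →ₗ[k] N} (hh : IsComoduleHom k C h) :
    IsSubcomodule k C (LinearMap.ker h) :=
  isSubcomodule_bot.comap hh

/-- `D ⊗ D` is the intersection of `D ⊗ C` and `C ⊗ D`, and each of these two is tested by slicing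
on one side. -/
theorem isSubcoalgebra_iff (D : Submodule k C) : IsSubcoalgebra k D ↔
    ∀ (f : C →ₗ[k] k), ∀ x ∈ D, coactBy C f x ∈ D ∧ coeffMap C f x ∈ D := by
  constructor
  · intro h f x hx
    obtain ⟨t, ht⟩ := h x hx
    constructor
    · change sliceRight C f (Coalgebra.comul x) ∈ D
      rw [← ht, sliceRight_map]
      exact Subtype.prop _
    · change sliceLeft C f (Coalgebra.comul x) ∈ D
      rw [← ht, sliceLeft_map]
      exact Subtype.prop _
  · intro h x hx
    apply mem_range_map_subtype
    · refine eq_zero_of_sliceRight _ fun g => ?_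
      rw [sliceRight_rTensor]
      exact (Submodule.Quotient.mk_eq_zero D).2 (h g x hx).1
    · refine eq_zero_of_sliceLeft _ fun g => ?_
      have := sliceLeft_map g LinearMap.id D.mkQ (Coalgebra.comul (R := k) x)
      refine this.trans ?_
      exact (Submodule.Quotient.mk_eq_zero D).2 (h g x hx).2

theorem IsSubcoalgebra.isSubcomodule {D : Submodule k C} (h : IsSubcoalgebra k D) :
    IsSubcomodule k C D :=
  (isSubcomodule_iff D).2 fun g x hx => ((isSubcoalgebra_iff D).1 h g x hx).1

theorem IsSubcoalgebra.inf {X Y : Submodule k C} (hX : IsSubcoalgebra k X)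
    (hY : IsSubcoalgebra k Y) : IsSubcoalgebra k (X ⊓ Y) := by
  rw [isSubcoalgebra_iff] at *
  exact fun g x hx => ⟨⟨(hX g x hx.1).1, (hY g x hx.2).1⟩, ⟨(hX g x hx.1).2, (hY g x hx.2).2⟩⟩

theorem IsSubcoalgebra.sSup {S : Set (Submodule k C)} (hS : ∀ X ∈ S, IsSubcoalgebra k X) :
    IsSubcoalgebra k (sSup S) := by
  rw [isSubcoalgebra_iff]
  exact fun g x hx => ⟨Submodule.mem_sSup_of_forall_map _
    (fun X hX y hy => ((isSubcoalgebra_iff X).1 (hS X hX) g y hy).1) x hx,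
    Submodule.mem_sSup_of_forall_map _
    (fun X hX y hy => ((isSubcoalgebra_iff X).1 (hS X hX) g y hy).2) x hx⟩

theorem IsSubcoalgebra.sup {X Y : Submodule k C} (hX : IsSubcoalgebra k X)
    (hY : IsSubcoalgebra k Y) : IsSubcoalgebra k (X ⊔ Y) := by
  rw [← sSup_pair]
  refine IsSubcoalgebra.sSup ?_
  rintro _ (rfl | rfl)
  exacts [hX, hY]

theorem isSubcoalgebra_coradical : IsSubcoalgebra k (coradical k C) :=
  IsSubcoalgebra.sSup fun _ h => h.1

/-- The working form of the wedge: the annihilator of `X` moves `x` into `Y`. Later arguments choose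
a suitable functional and apply this. -/
theorem mem_wedge_iff_coeffMap (X Y : Submodule k C) (x : C) : x ∈ wedge k X Y ↔
    ∀ f : C →ₗ[k] k, (∀ a ∈ X, f a = 0) → coeffMap C f x ∈ Y := by
  rw [mem_wedge_iff, mkQ_map_eq_zero_iff_left]; rfl

theorem mem_wedge_iff_coactBy (X Y : Submodule k C) (x : C) : x ∈ wedge k X Y ↔
    ∀ g : C →ₗ[k] k, (∀ y ∈ Y, g y = 0) → coactBy C g x ∈ X := by
  rw [mem_wedge_iff, mkQ_map_eq_zero_iff_right]; rfl

theorem wedge_bot_right_le (X : Submodule k C) : wedge k X ⊥ ≤ X := by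
  intro x hx
  refine mem_of_forall_functional X x fun f hf => ?_
  rw [← counit_coeffMap (C := C),
    (Submodule.mem_bot k).1 ((mem_wedge_iff_coeffMap X ⊥ x).1 hx f hf), map_zero]

/-- If two functionals agree on a right coideal, their actions on it agree. -/
theorem coeffMap_congr {X : Submodule k M} (hX : IsSubcomodule k C X) {e f : M →ₗ[k] k}
    (h : ∀ x ∈ X, e x = f x) {x : M} (hx : x ∈ X) : coeffMap C e x = coeffMap C f x := by
  obtain ⟨t, ht⟩ := hX x hx
  simp only [coeffMap, LinearMap.comp_apply]
  rw [← ht, sliceLeft_rTensor, sliceLeft_rTensor]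
  congr 2
  ext y
  exact h y y.2

theorem IsSubcoalgebra.coactBy_congr {X : Submodule k C} (hX : IsSubcoalgebra k X)
    {e f : C →ₗ[k] k} (h : ∀ x ∈ X, e x = f x) {x : C} (hx : x ∈ X) :
    coactBy C e x = coactBy C f x := by
  obtain ⟨t, ht⟩ := hX x hx
  change sliceRight C e (Coalgebra.comul x) = sliceRight C f (Coalgebra.comul x)
  rw [← ht, sliceRight_map, sliceRight_map]
  congr 3
  ext y
  exact h y y.2

theorem coeffMap_eq_self {X : Submodule k C} (hX : IsSubcomodule k C X) {e : C →ₗ[k] k}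
    (h : ∀ x ∈ X, e x = Coalgebra.counit (R := k) x) {x : C} (hx : x ∈ X) : coeffMap C e x = x :=
  (coeffMap_congr hX h hx).trans (coeffMap_counit x)

theorem coeffMap_eq_zero {X : Submodule k M} (hX : IsSubcomodule k C X) {e : M →ₗ[k] k}
    (h : ∀ x ∈ X, e x = 0) {x : M} (hx : x ∈ X) : coeffMap C e x = 0 := by
  rw [coeffMap_congr hX (f := 0) h hx, (coeffMap_eq_zero_iff (C := C) (0 : M →ₗ[k] k)).2 rfl,
    LinearMap.zero_apply]

/-! ### Local finiteness -/

theorem exists_fg_range_slice {V W : Type*} [AddCommGroup V] [Module k V] [AddCommGroup W]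
    [Module k W] (t : V ⊗[k] W) :
    ∃ X : Submodule k V, X.FG ∧ ∀ g : W →ₗ[k] k, sliceRight V g t ∈ X := by
  induction t with
  | zero => exact ⟨⊥, Submodule.fg_bot, fun g => by simp⟩
  | add x y hx hy =>
    obtain ⟨X, hX, hx⟩ := hx
    obtain ⟨Y, hY, hy⟩ := hy
    refine ⟨X ⊔ Y, hX.sup hY, fun g => ?_⟩
    rw [map_add]
    exact Submodule.add_mem_sup (hx g) (hy g)
  | tmul x y =>
    refine ⟨Submodule.span k {x}, Submodule.fg_span_singleton x, fun g => ?_⟩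
    rw [sliceRight_tmul]
    exact Submodule.smul_mem _ _ (Submodule.mem_span_singleton_self x)

theorem Submodule.FG.of_le' {V : Type*} [AddCommGroup V] [Module k V] {X Y : Submodule k V}
    (hY : Y.FG) (h : X ≤ Y) : X.FG := by
  have : FiniteDimensional k Y := Module.Finite.iff_fg.2 hY
  exact Module.Finite.iff_fg.1 (Submodule.finiteDimensional_of_le h)

/-- The finiteness theorem for comodules. -/
theorem exists_fg_subcomodule (m : M) :
    ∃ X : Submodule k M, X.FG ∧ IsSubcomodule k C X ∧ m ∈ X := by
  obtain ⟨Y, hY, hm⟩ := exists_fg_range_slice (RightComodule.coact (k := k) (C := C) m)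
  -- The subcomodule is the orbit of `m` under the dual algebra; it is finite-dimensional because it
  -- lies in the span of the finitely many left legs of the coaction of `m`.
  refine ⟨Submodule.span k (Set.range fun g : C →ₗ[k] k => coactBy M g m), hY.of_le' ?_, ?_, ?_⟩
  · rw [Submodule.span_le]
    rintro _ ⟨g, rfl⟩
    exact hm g
  · rw [isSubcomodule_iff]
    intro g
    refine (?_ : Submodule.span k (Set.range fun g : C →ₗ[k] k => coactBy M g m) ≤
      Submodule.comap (coactBy M g)
        (Submodule.span k (Set.range fun g : C →ₗ[k] k => coactBy M g m)))
    rw [Submodule.span_le]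
    rintro _ ⟨f, rfl⟩
    exact Submodule.subset_span ⟨_, (coactBy_coactBy g f m).symm⟩
  · exact Submodule.subset_span ⟨_, coactBy_counit m⟩

variable (k) in
/-- The span of the coefficients of a subspace. -/
noncomputable def coefficientSpan (X : Submodule k C) : Submodule k C :=
  ⨆ f : C →ₗ[k] k, X.map (coeffMap C f)

theorem le_coefficientSpan (X : Submodule k C) : X ≤ coefficientSpan k X := fun x hx =>
  Submodule.mem_iSup_of_mem Coalgebra.counit ⟨x, hx, coeffMap_counit x⟩

theorem isSubcoalgebra_coefficientSpan {X : Submodule k C} (hX : IsSubcomodule k C X) :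
    IsSubcoalgebra k (coefficientSpan k X) := by
  rw [isSubcoalgebra_iff]
  intro f
  have h1 : coefficientSpan k X ≤ (coefficientSpan k X).comap (coactBy C f) := by
    refine iSup_le fun g => ?_
    rintro _ ⟨y, hy, rfl⟩
    exact Submodule.mem_iSup_of_mem g
      ⟨coactBy C f y, (isSubcomodule_iff X).1 hX f y hy, coeffMap_coactBy g f y⟩
  have h2 : coefficientSpan k X ≤ (coefficientSpan k X).comap (coeffMap C f) := by
    refine iSup_le fun g => ?_
    rintro _ ⟨y, hy, rfl⟩
    exact Submodule.mem_iSup_of_mem _ ⟨y, hy, (coeffMap_coeffMap f g y).symm⟩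
  exact fun x hx => ⟨h1 hx, h2 hx⟩

theorem fg_coefficientSpan {X : Submodule k C} (hfg : X.FG) : (coefficientSpan k X).FG := by
  have key : ∀ x : C, ∃ Y : Submodule k C, Y.FG ∧ ∀ f : C →ₗ[k] k, coeffMap C f x ∈ Y := by
    intro x
    obtain ⟨Y, hY, h⟩ := exists_fg_range_slice
      (TensorProduct.comm k C C (Coalgebra.comul (R := k) x))
    refine ⟨Y, hY, fun f => ?_⟩
    convert h f using 1
    change sliceLeft C f (Coalgebra.comul x) = _
    generalize Coalgebra.comul (R := k) x = t
    induction t with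
    | zero => simp
    | add x y hx hy => simp [hx, hy]
    | tmul x y => simp
  choose Y hY h using key
  obtain ⟨s, rfl⟩ := hfg
  refine Submodule.FG.of_le' (Submodule.fg_biSup s Y fun x _ => hY x) ?_
  refine iSup_le fun f => ?_
  rw [Submodule.map_span_le]
  intro x hx
  exact Submodule.mem_iSup_of_mem x (Submodule.mem_iSup_of_mem hx (h x f))
/-- A nonzero finite-dimensional subspace with a property contains a minimal such one. -/
theorem exists_minimal_of_fg {V : Type*} [AddCommGroup V] [Module k V] (P : Submodule k V → Prop)
    {X : Submodule k V} (hX : X.FG) (hP : P X) :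
    ∃ Y ≤ X, P Y ∧ ∀ Z ≤ Y, P Z → Z = Y := by
  classical
  have hfd : ∀ Y ≤ X, FiniteDimensional k Y := fun Y h => Module.Finite.iff_fg.2 (hX.of_le' h)
  have hex : ∃ n, ∃ Y ≤ X, P Y ∧ Module.finrank k Y = n := ⟨_, X, le_rfl, hP, rfl⟩
  obtain ⟨Y, hYX, hY, hn⟩ := Nat.find_spec hex
  refine ⟨Y, hYX, hY, fun Z hZ hPZ => ?_⟩
  have := hfd Y hYX
  refine Submodule.eq_of_le_of_finrank_le hZ ?_
  rw [hn]
  exact Nat.find_min' hex ⟨Z, hZ.trans hYX, hPZ, rfl⟩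

/-! ### Minimal right coideals and the coradical -/

variable (k) in
/-- A minimal nonzero subcomodule. -/
def IsMinimalSubcomodule (C : Type v) [AddCommGroup C] [Module k C] [Coalgebra k C] {M : Type v}
    [AddCommGroup M] [Module k M] [RightComodule k C M] (T : Submodule k M) : Prop :=
  IsSubcomodule k C T ∧ T ≠ ⊥ ∧ ∀ X ≤ T, IsSubcomodule k C X → X ≠ ⊥ → X = T

theorem exists_isMinimalSubcomodule_le {X : Submodule k M} (hfg : X.FG) (hX : IsSubcomodule k C X)
    (h0 : X ≠ ⊥) : ∃ T ≤ X, IsMinimalSubcomodule k C T := by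
  obtain ⟨T, hTX, hT, hmin⟩ := exists_minimal_of_fg
    (fun Y : Submodule k M => IsSubcomodule k C Y ∧ Y ≠ ⊥) hfg ⟨hX, h0⟩
  exact ⟨T, hTX, hT.1, hT.2, fun Z hZ h1 h2 => hmin Z hZ ⟨h1, h2⟩⟩

theorem IsMinimalSubcomodule.fg {T : Submodule k M} (hT : IsMinimalSubcomodule k C T) : T.FG := by
  obtain ⟨t, ht, h0⟩ := T.ne_bot_iff.1 hT.2.1
  obtain ⟨X, hXfg, hX, htX⟩ := exists_fg_subcomodule (k := k) (C := C) t
  rw [← hT.2.2 (X ⊓ T) inf_le_right (hX.inf hT.1)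
    ((Submodule.ne_bot_iff _).2 ⟨t, ⟨htX, ht⟩, h0⟩)]
  exact hXfg.of_le' inf_le_left

/-- A minimal right coideal is contained in a simple subcoalgebra. -/
theorem IsMinimalSubcomodule.exists_le_simple {T : Submodule k C}
    (hT : IsMinimalSubcomodule k C T) : ∃ D, IsSimpleSubcoalgebra k D ∧ T ≤ D := by
  have hT' := (isSubcomodule_iff T).1 hT.1
  set D₀ : Submodule k C := coefficientSpan k T
  have hD₀0 : D₀ ≠ ⊥ := fun h => hT.2.1 (le_bot_iff.1 ((le_coefficientSpan T).trans h.le))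
  obtain ⟨D, hDD₀, ⟨hD, hD0⟩, hmin⟩ := exists_minimal_of_fg
    (fun Y : Submodule k C => IsSubcoalgebra k Y ∧ Y ≠ ⊥) 
    (fg_coefficientSpan hT.fg) ⟨isSubcoalgebra_coefficientSpan hT.1, hD₀0⟩
  refine ⟨D, ⟨hD, hD0, fun D' hD' hle => or_iff_not_imp_left.2 fun h => hmin D' hle ⟨hD', h⟩⟩, ?_⟩
  -- `D` is a minimal subcoalgebra among the coefficients of `T`. The aim is a colinear embedding of
  -- `T` into `D`; `Y` serves as a substitute for a complement of `D`.
  obtain ⟨Y, hY, hYD, hYmax⟩ := exists_maximal_disjoint (IsSubcomodule k C)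
    (fun S hS => IsSubcomodule.sSup hS) D
  have hex : ∃ f : C →ₗ[k] k, ¬ T.map (coeffMap C f) ≤ Y := by
    by_contra! hcon
    have : D ≤ Y := hDD₀.trans (iSup_le hcon)
    exact hD0 (by rw [← hYD, inf_eq_right.2 this])
  obtain ⟨f, hf⟩ := hex
  have hmeet : (Y ⊔ T.map (coeffMap C f)) ⊓ D ≠ ⊥ := fun h =>
    hf (le_sup_right.trans (hYmax _ (hY.sup (hT.1.map (isComoduleHom_coeffMap f))) le_sup_left h))
  obtain ⟨d, ⟨hd, hdD⟩, hd0⟩ := (Submodule.ne_bot_iff _).1 hmeet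
  obtain ⟨y, hy, _, ⟨t, ht, rfl⟩, rfl⟩ := Submodule.mem_sup.1 hd
  obtain ⟨e, he1, he0⟩ := exists_functional_of_disjoint hYD Coalgebra.counit
  -- `e` acts as the identity on `D` and as zero on `Y`, so `ψ` sends `t` to the nonzero element `y
  -- + coeffMap C f t` of `D`. Minimality of `T` then makes `ψ` injective on `T` with values in `D`.
  set ψ := coeffMap C (e ∘ₗ coeffMap C f) with hψ
  have hψh : IsComoduleHom k C ψ := isComoduleHom_coeffMap _
  have hψt : ψ t = y + coeffMap C f t := by
    rw [hψ, ← coeffMap_coeffMap, ← coeffMap_eq_self hD.isSubcomodule he1 hdD, map_add,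
      coeffMap_eq_zero hY he0 hy, zero_add]
  have hmap : T ⊓ D.comap ψ = T := by
    refine hT.2.2 _ inf_le_left (hT.1.inf (hD.isSubcomodule.comap hψh))
      ((Submodule.ne_bot_iff _).2 ⟨t, ⟨ht, ?_⟩, ?_⟩)
    · exact (show ψ t ∈ D from hψt ▸ hdD)
    · rintro rfl; exact hd0 (by rw [← hψt, map_zero])
  have hinj : T ⊓ LinearMap.ker ψ = ⊥ := by
    by_contra hne
    have h := hT.2.2 _ inf_le_left (hT.1.inf (IsSubcomodule.ker hψh)) hne
    refine hd0 ?_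
    rw [← hψt]
    exact ((h.symm.le ht).2 : _)
  intro x hx
  -- A functional vanishing on `D` acts as zero on `D`, hence on `T` through the embedding `ψ`;
  -- applying the counit shows that it vanishes on `T`.
  refine mem_of_forall_functional D x fun g hg => ?_
  have h1 : ψ (coactBy C g x) = 0 := by
    rw [hψh.map_coactBy, hD.coactBy_congr (f := 0) hg ((hmap.symm.le hx).2 : _)]
    simp [coactBy, sliceRight]
  have h2 : coactBy C g x = 0 := (Submodule.eq_bot_iff _).1 hinj _ ⟨hT' g x hx, h1⟩
  rw [← counit_coactBy, h2, map_zero]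

theorem IsMinimalSubcomodule.le_coradical {T : Submodule k C} (hT : IsMinimalSubcomodule k C T) :
    T ≤ coradical k C := by
  obtain ⟨D, hD, hTD⟩ := hT.exists_le_simple
  exact hTD.trans (le_sSup hD)

theorem coradicalFiltrationPred_mono : Monotone (coradicalFiltrationPred k C) := by
  refine monotone_nat_of_le_succ fun n => ?_
  induction n with
  | zero => exact bot_le
  | succ n ih =>
    rw [coradicalFiltrationPred_succ, coradicalFiltrationPred_succ (n + 1)]
    exact wedge_mono ih le_rfl

theorem IsSubcomodule.wedge (X : Submodule k C) {Y : Submodule k C} (hY : IsSubcomodule k C Y) :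
    IsSubcomodule k C (wedge k X Y) := by
  rw [isSubcomodule_iff]
  intro g x hx
  rw [mem_wedge_iff_coeffMap] at hx ⊢
  intro f hf
  rw [coeffMap_coactBy]
  exact (isSubcomodule_iff Y).1 hY g _ (hx f hf)

theorem isSubcomodule_coradicalFiltrationPred (n : ℕ) :
    IsSubcomodule k C (coradicalFiltrationPred k C n) := by
  cases n with
  | zero => exact isSubcomodule_bot
  | succ n =>
    rw [coradicalFiltrationPred_succ]
    exact IsSubcomodule.wedge _ isSubcoalgebra_coradical.isSubcomodule

theorem eventually_const_of_fg {V : Type*} [AddCommGroup V] [Module k V] {B : Submodule k V}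
    (hB : B.FG) {F : ℕ → Submodule k V} (hF : Monotone F) :
    ∃ N, ∀ n, N ≤ n → B ⊓ F n = B ⊓ F N := by
  have : FiniteDimensional k B := Module.Finite.iff_fg.2 hB
  obtain ⟨N, hN⟩ := monotone_stabilizes_iff_noetherian.2 (inferInstance : IsNoetherian k B)
    ⟨fun n => (F n).comap B.subtype, fun m n h => Submodule.comap_mono (hF h)⟩
  refine ⟨N, fun n hn => ?_⟩
  have := congrArg (Submodule.map B.subtype) (hN n hn)
  change Submodule.map _ (Submodule.comap _ _) = Submodule.map _ (Submodule.comap _ _) at this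
  rw [Submodule.map_comap_subtype, Submodule.map_comap_subtype] at this
  exact this.symm

/-- The coradical filtration is exhaustive. -/
theorem exists_mem_coradicalFiltrationPred (c : C) : ∃ n, c ∈ coradicalFiltrationPred k C n := by
  obtain ⟨B, hBfg, hB, hc⟩ := exists_fg_subcomodule (k := k) (C := C) c
  obtain ⟨N, hN⟩ := eventually_const_of_fg hBfg coradicalFiltrationPred_mono
  refine ⟨N, ?_⟩
  by_contra hcN
  set P := B ⊓ coradicalFiltrationPred k C N with hP
  have hPc : IsSubcomodule k C P := hB.inf (isSubcomodule_coradicalFiltrationPred N)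
  -- `X` is minimal among the subcomodules of `B` strictly above `P`, so `X / P` is simple. Showing
  -- that `X` lies in the next filtration step contradicts stabilization at `N`.
  obtain ⟨X, hXB, ⟨hX, hPX, hXP⟩, hmin⟩ := exists_minimal_of_fg
    (fun Y : Submodule k C => IsSubcomodule k C Y ∧ P ≤ Y ∧ ¬ Y ≤ P) hBfg
    ⟨hB, inf_le_left, fun h => hcN (h hc).2⟩
  refine hXP ?_
  rw [← hN (N + 1) (Nat.le_succ N)]
  refine le_inf hXB fun x hx => ?_
  rw [coradicalFiltrationPred_succ, mem_wedge_iff_coeffMap]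
  intro f hf
  have hfP : P ≤ LinearMap.ker (coeffMap C f) := fun y hy =>
    coeffMap_eq_zero hPc (fun z hz => hf z hz.2) hy
  by_cases h0 : X.map (coeffMap C f) = ⊥
  · have : coeffMap C f x ∈ X.map (coeffMap C f) := ⟨x, hx, rfl⟩
    rw [h0] at this
    rw [(Submodule.mem_bot k).1 this]
    exact zero_mem _
  · refine IsMinimalSubcomodule.le_coradical (T := X.map (coeffMap C f))
      ⟨hX.map (isComoduleHom_coeffMap f), h0, fun Z hZ hZc hZ0 => ?_⟩ ⟨x, hx, rfl⟩
    have hW : X ⊓ Z.comap (coeffMap C f) = X := by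
      refine hmin _ inf_le_left ⟨hX.inf (hZc.comap (isComoduleHom_coeffMap f)),
        le_inf hPX fun y hy => ?_, fun hle => hZ0 ?_⟩
      · rw [Submodule.mem_comap, LinearMap.mem_ker.1 (hfP hy)]
        exact zero_mem _
      · refine (Submodule.eq_bot_iff _).2 fun z hz => ?_
        obtain ⟨y, hy, rfl⟩ := hZ hz
        exact hfP (hle ⟨hy, hz⟩)
    refine le_antisymm hZ ?_
    rintro _ ⟨y, hy, rfl⟩
    exact (hW.symm.le hy).2

end Lattice

/-! ### The layer criterion for left semiperfectness -/

section Criterion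

variable {k : Type u} {C : Type v} [Field k] [AddCommGroup C] [Module k C] [Coalgebra k C]
  {M N : Type v} [AddCommGroup M] [Module k M] [RightComodule k C M]
  [AddCommGroup N] [Module k N] [RightComodule k C N]

variable (k C) in
/-- For every simple subcoalgebra `D`, the part of `⨁ₙ Cₙ / Cₙ₋₁` which is supported on the left
by `D`, namely `⨁ₙ (D ∧ Cₙ₋₁) / Cₙ₋₁`, is finite-dimensional. -/
def IsLoewyFinite : Prop :=
  ∀ D : Submodule k C, IsSimpleSubcoalgebra k D →
    (∀ n, ((wedge k D (coradicalFiltrationPred k C n)).map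
      (coradicalFiltrationPred k C n).mkQ).FG) ∧
    ∃ N, ∀ n, N ≤ n → wedge k D (coradicalFiltrationPred k C n) ≤ coradicalFiltrationPred k C n

/-- A simple subcoalgebra has a complement in the coradical. -/
theorem IsSimpleSubcoalgebra.exists_complement {D : Submodule k C} (hD : IsSimpleSubcoalgebra k D) :
    ∃ Y : Submodule k C, IsSubcoalgebra k Y ∧ Y ⊓ D = ⊥ ∧ coradical k C ≤ Y ⊔ D := by
  obtain ⟨Y, hY, hYD, hmax⟩ := exists_maximal_disjoint (IsSubcoalgebra k)
    (fun S hS => IsSubcoalgebra.sSup hS) D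
  refine ⟨Y, hY, hYD, sSup_le fun B hB => ?_⟩
  rcases hB.2.2 _ (hB.1.inf (hY.sup hD.1)) inf_le_left with h | h
  -- If `B` misses `Y ⊔ D`, then `Y ⊔ B` still misses `D`, so maximality of `Y` absorbs `B`.
  · refine (le_sup_right.trans (hmax (Y ⊔ B) (hY.sup hB.1) le_sup_left ?_)).trans le_sup_left
    refine (Submodule.eq_bot_iff _).2 ?_
    rintro x ⟨hx, hxD⟩
    obtain ⟨y, hy, b, hb, rfl⟩ := Submodule.mem_sup.1 hx
    have hb0 : b = 0 := by
      refine (Submodule.eq_bot_iff _).1 h b ⟨hb, ?_⟩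
      have : b = -y + (y + b) := by abel
      rw [this]
      exact Submodule.add_mem_sup (neg_mem hy) hxD
    subst hb0
    exact (Submodule.eq_bot_iff _).1 hYD _ ⟨by simpa using hy, hxD⟩
  · exact inf_eq_left.1 h

/-- Split the coradical along `D` and a complementary subcoalgebra `Y`. The functional that is `ε`
on `Y` and zero on `D` acts as the projection to `Y` and preserves `E`; but `E ⊓ Y` is zero, since
it misses `D`. -/
theorem inf_coradical_le {D : Submodule k C} (hD : IsSimpleSubcoalgebra k D) {E : Submodule k C}
    (hE : IsSubcomodule k C E)
    (hess : ∀ X ≤ E, IsSubcomodule k C X → X ≠ ⊥ → X ⊓ D ≠ ⊥) : E ⊓ coradical k C ≤ D := by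
  obtain ⟨Y, hY, hYD, hle⟩ := hD.exists_complement
  rintro x ⟨hxE, hx⟩
  obtain ⟨y, hy, d, hd, rfl⟩ := Submodule.mem_sup.1 (hle hx)
  obtain ⟨e, he1, he0⟩ := exists_functional_of_disjoint ((inf_comm _ _).trans hYD)
    (Coalgebra.counit (R := k) (A := C))
  have h := (isSubcomodule_iff E).1 hE e _ hxE
  rw [map_add, hY.coactBy_congr he1 hy, coactBy_counit, hD.1.coactBy_congr (f := 0) he0 hd] at h
  have h0 : coactBy C (0 : C →ₗ[k] k) d = 0 := by simp [coactBy, sliceRight]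
  rw [h0, add_zero] at h
  have hEY : E ⊓ Y = ⊥ := by
    by_contra hne
    refine hess _ inf_le_left (hE.inf hY.isSubcomodule) hne ?_
    rw [inf_assoc, hYD, inf_bot_eq]
  rw [(Submodule.eq_bot_iff _).1 hEY y ⟨h, hy⟩, zero_add]
  exact hd

/-- A functional killing `Cₙ₋₁` sends `E ∩ Cₙ` into `E ∩ C₀ ⊆ D`, whence `E ∩ Cₙ ⊆ D ∧ Cₙ₋₁`. The
criterion therefore bounds each layer of `E` and kills the high ones. -/
theorem IsLoewyFinite.fg_of_essential (hC : IsLoewyFinite k C) {D : Submodule k C}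
    (hD : IsSimpleSubcoalgebra k D) {E : Submodule k C} (hE : IsSubcomodule k C E)
    (hess : ∀ X ≤ E, IsSubcomodule k C X → X ≠ ⊥ → X ⊓ D ≠ ⊥) : E.FG := by
  have hle : ∀ n, E ⊓ coradicalFiltrationPred k C (n + 1) ≤
      wedge k D (coradicalFiltrationPred k C n) := by
    rintro n x ⟨hxE, hx⟩
    -- Writing the index as `1 + n` puts `C₀`, which has shifted index `1`, in the left factor of
    -- the wedge.
    rw [add_comm] at hx
    have hx' := coradicalFiltrationPred_add_le 1 n hx
    rw [mem_wedge_iff_coactBy] at hx' ⊢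
    exact fun g hg => inf_coradical_le hD hE hess ⟨(isSubcomodule_iff E).1 hE g x hxE, hx' g hg⟩
  obtain ⟨hfg, N, hN⟩ := hC D hD
  have hfin : ∀ n, (E ⊓ coradicalFiltrationPred k C n).FG := by
    intro n
    induction n with
    | zero => exact Submodule.fg_bot.of_le' inf_le_right
    | succ n ih =>
      refine Submodule.fg_of_fg_map_of_fg_inf_ker (coradicalFiltrationPred k C n).mkQ ?_ ?_
      · exact (hfg n).of_le' (Submodule.map_mono (hle n))
      · rw [Submodule.ker_mkQ]
        exact ih.of_le' (inf_le_inf_right _ inf_le_left)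
  have hstab : ∀ n, E ⊓ coradicalFiltrationPred k C n ≤ E ⊓ coradicalFiltrationPred k C N := by
    intro n
    rcases le_total n N with h | h
    · exact inf_le_inf_left _ (coradicalFiltrationPred_mono h)
    · induction n, h using Nat.le_induction with
      | base => exact le_rfl
      | succ n hn ih => exact (le_inf inf_le_left ((hle n).trans (hN n hn))).trans ih
  refine (hfin N).of_le' fun x hx => ?_
  obtain ⟨n, hn⟩ := exists_mem_coradicalFiltrationPred (k := k) x
  exact hstab n ⟨hx, hn⟩

/-- A nonzero functional on `S`, extended linearly to `E`, gives a colinear map `φ : E → C`. It is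
injective on `S` by simplicity, hence on `E` by essentiality, so `E` may be treated as a right
coideal of `C`. -/
theorem IsLoewyFinite.isLeftSemiperfect (hC : IsLoewyFinite k C) : IsLeftSemiperfect k C := by
  intro S E _ _ _ _ _ _ i hS hi
  obtain ⟨hnt, hS⟩ := hS
  obtain ⟨hih, hinj, -, hess⟩ := hi
  obtain ⟨s, hs⟩ := exists_ne (0 : S)
  obtain ⟨f, hfs⟩ : ∃ f : S →ₗ[k] k, f s ≠ 0 := by
    by_contra! h
    exact hs ((Module.forall_dual_apply_eq_zero_iff k s).1 h)
  obtain ⟨l, hl⟩ := LinearMap.exists_leftInverse_of_injective i (LinearMap.ker_eq_bot.2 hinj)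
  set φ := coeffMap C (f ∘ₗ l)
  have hφ : IsComoduleHom k C φ := isComoduleHom_coeffMap _
  have hφi : φ ∘ₗ i = coeffMap C f := by
    rw [coeffMap_comp hih, LinearMap.comp_assoc, hl, LinearMap.comp_id]
  have hkerf : LinearMap.ker (coeffMap C f) = ⊥ := by
    refine (hS _ (IsSubcomodule.ker (isComoduleHom_coeffMap f))).resolve_right fun h => hfs ?_
    rw [← counit_coeffMap (C := C), LinearMap.mem_ker.1 (h.symm.le trivial : s ∈ _), map_zero]
  have hT : IsMinimalSubcomodule k C (LinearMap.range (coeffMap C f)) := by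
    refine ⟨IsSubcomodule.range (isComoduleHom_coeffMap f), fun h => ?_, fun X hX hXc h0 => ?_⟩
    · have hs' : coeffMap C f s ∈ LinearMap.range (coeffMap C f) := ⟨s, rfl⟩
      rw [h] at hs'
      exact hs ((Submodule.eq_bot_iff _).1 hkerf s hs')
    · refine le_antisymm hX ?_
      rcases hS _ (hXc.comap (isComoduleHom_coeffMap f)) with h | h
      · refine absurd ((Submodule.eq_bot_iff _).2 fun x hx => ?_) h0
        obtain ⟨t, rfl⟩ := hX hx
        rw [(Submodule.eq_bot_iff _).1 h t hx, map_zero]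
      · rintro _ ⟨t, rfl⟩
        exact (h.symm.le trivial : t ∈ X.comap _)
  obtain ⟨D, hD, hTD⟩ := hT.exists_le_simple
  have hker : LinearMap.ker φ = ⊥ := by
    by_contra hne
    refine hess _ (IsSubcomodule.ker hφ) hne ((Submodule.eq_bot_iff _).2 ?_)
    rintro _ ⟨hx, t, rfl⟩
    have : coeffMap C f t = 0 := by rw [← hφi]; exact hx
    rw [(Submodule.eq_bot_iff _).1 hkerf t this, map_zero]
  have hfg : (LinearMap.range φ).FG := by
    refine hC.fg_of_essential hD (IsSubcomodule.range hφ) fun X hX hXc h0 => ?_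
    have hne : X.comap φ ≠ ⊥ := fun h => h0 ((Submodule.eq_bot_iff _).2 fun x hx => by
      obtain ⟨t, rfl⟩ := hX hx
      rw [(Submodule.eq_bot_iff _).1 h t hx, map_zero])
    obtain ⟨_, ⟨hx, t, rfl⟩, hx0⟩ := (Submodule.ne_bot_iff _).1 (hess _ (hXc.comap hφ) hne)
    refine (Submodule.ne_bot_iff _).2 ⟨φ (i t), ⟨hx, hTD ⟨t, ?_⟩⟩, fun h => hx0 ?_⟩
    · rw [← hφi]; rfl
    · exact (Submodule.eq_bot_iff _).1 hker _ h
  have : FiniteDimensional k (LinearMap.range φ) := Module.Finite.iff_fg.2 hfg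
  exact Module.Finite.equiv (LinearEquiv.ofInjective φ (LinearMap.ker_eq_bot.1 hker)).symm

/-! ### The comodule structure on a subcomodule -/

/-- The coaction on a subcomodule. -/
noncomputable def IsSubcomodule.coact {X : Submodule k M} (hX : IsSubcomodule k C X) :
    X →ₗ[k] X ⊗[k] C :=
  (LinearEquiv.ofInjective _ (Module.Flat.rTensor_preserves_injective_linearMap (M := C) X.subtype
    X.subtype_injective)).symm.toLinearMap ∘ₗ
    LinearMap.codRestrict _ (RightComodule.coact ∘ₗ X.subtype) (fun x => hX x x.2)

theorem IsSubcomodule.rTensor_comp_coact {X : Submodule k M} (hX : IsSubcomodule k C X) :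
    LinearMap.rTensor C X.subtype ∘ₗ hX.coact = RightComodule.coact ∘ₗ X.subtype := by
  ext x
  exact congrArg Subtype.val (LinearEquiv.apply_symm_apply (LinearEquiv.ofInjective _
    (Module.Flat.rTensor_preserves_injective_linearMap (M := C) X.subtype X.subtype_injective))
    (LinearMap.codRestrict _ (RightComodule.coact ∘ₗ X.subtype) (fun x => hX x x.2) x))

/-- A subcomodule is a comodule. -/
@[reducible] noncomputable def IsSubcomodule.rightComodule {X : Submodule k M}
    (hX : IsSubcomodule k C X) : RightComodule k C X where
  coact := hX.coact
  coassoc := by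
    have hinj : Function.Injective (LinearMap.rTensor (C ⊗[k] C) X.subtype) :=
      Module.Flat.rTensor_preserves_injective_linearMap _ X.subtype_injective
    ext x
    apply hinj
    have h := LinearMap.congr_fun hX.rTensor_comp_coact x
    have hM := LinearMap.congr_fun (RightComodule.coassoc (k := k) (C := C) (M := M)) x
    simp only [LinearMap.comp_apply, LinearEquiv.coe_coe, Submodule.subtype_apply] at h hM ⊢
    have e1 : ∀ t : X ⊗[k] C, LinearMap.rTensor (C ⊗[k] C) X.subtype (TensorProduct.assoc k X C C
        (LinearMap.rTensor C hX.coact t)) = TensorProduct.assoc k M C C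
          (LinearMap.rTensor C RightComodule.coact (LinearMap.rTensor C X.subtype t)) := fun t => by
      rw [← LinearMap.rTensor_comp_apply, ← hX.rTensor_comp_coact, LinearMap.rTensor_comp_apply]
      exact (TensorProduct.map_map_assoc X.subtype LinearMap.id LinearMap.id _).symm.trans
        (by rw [TensorProduct.map_id]; rfl) |>.symm
    have e2 : ∀ t : X ⊗[k] C, LinearMap.rTensor (C ⊗[k] C) X.subtype (LinearMap.lTensor X
        Coalgebra.comul t) = LinearMap.lTensor M Coalgebra.comul
          (LinearMap.rTensor C X.subtype t) := fun t => by
      rw [← LinearMap.comp_apply, ← LinearMap.comp_apply, LinearMap.rTensor_comp_lTensor,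
        LinearMap.lTensor_comp_rTensor]
    rw [e1, e2, h, hM]
  counit := by
    ext x
    have h := LinearMap.congr_fun hX.rTensor_comp_coact x
    simp only [LinearMap.comp_apply, Submodule.subtype_apply] at h
    have e := sliceRight_rTensor (Coalgebra.counit (R := k) (A := C)) X.subtype (hX.coact x)
    rw [h] at e
    exact e.symm.trans (coactBy_counit (k := k) (C := C) (x : M))

theorem IsSubcomodule.isComoduleHom_subtype {X : Submodule k M} (hX : IsSubcomodule k C X) :
    letI := hX.rightComodule
    IsComoduleHom k C X.subtype :=
  hX.rTensor_comp_coact.symm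

theorem IsSubcomodule.isComoduleHom_of_subtype_comp {X : Submodule k M} (hX : IsSubcomodule k C X)
    (f : N →ₗ[k] X) (hf : IsComoduleHom k C (X.subtype ∘ₗ f)) :
    letI := hX.rightComodule
    IsComoduleHom k C f := by
  have hinj : Function.Injective (LinearMap.rTensor C X.subtype) :=
    Module.Flat.rTensor_preserves_injective_linearMap _ X.subtype_injective
  refine LinearMap.ext fun x => hinj ?_
  have h := LinearMap.congr_fun hf x
  rw [LinearMap.rTensor_comp] at h
  exact (LinearMap.congr_fun hX.rTensor_comp_coact (f x)).trans h

/-- A right coideal onto which `C` retracts is injective. -/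
theorem isInjectiveComodule_of_retract {E : Submodule k C} (hE : IsSubcomodule k C E)
    (e : C →ₗ[k] k) (he : ∀ x ∈ E, e x = Coalgebra.counit (R := k) x)
    (hrange : ∀ x, coeffMap C e x ∈ E) :
    letI := hE.rightComodule
    IsInjectiveComodule k C E := by
  let := hE.rightComodule
  intro X Y _ _ _ _ _ _ i f hi hinj hf
  obtain ⟨l, hl⟩ := LinearMap.exists_leftInverse_of_injective i (LinearMap.ker_eq_bot.2 hinj)
  have hsf : IsComoduleHom k C (E.subtype ∘ₗ f) := by
    have h1 := hE.isComoduleHom_subtype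
    rw [IsComoduleHom] at *
    rw [← LinearMap.comp_assoc, h1, LinearMap.comp_assoc, hf, LinearMap.rTensor_comp,
      LinearMap.comp_assoc]
  -- By cofreeness, extending a colinear map into `C` only needs a linear extension of its
  -- functional; the result is then pushed back to `E` by the retraction.
  set h : Y →ₗ[k] k := Coalgebra.counit ∘ₗ E.subtype ∘ₗ f ∘ₗ l with hh
  refine ⟨LinearMap.codRestrict E (coeffMap C e ∘ₗ coeffMap C h) (fun y => hrange _), ?_, ?_⟩
  · refine hE.isComoduleHom_of_subtype_comp _ ?_
    rw [LinearMap.subtype_comp_codRestrict, coeffMap_comp (isComoduleHom_coeffMap h)]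
    exact isComoduleHom_coeffMap _
  · ext x
    have h1 : coeffMap C h ∘ₗ i = E.subtype ∘ₗ f := by
      rw [coeffMap_comp hi, hsf.eq_coeffMap]
      congr 1
      rw [hh]
      ext z
      have := LinearMap.congr_fun hl z
      simp only [LinearMap.comp_apply, LinearMap.id_apply] at this ⊢
      rw [this]
    have h2 := LinearMap.congr_fun h1 x
    change coeffMap C e (coeffMap C h (i x)) = f x
    rw [LinearMap.comp_apply] at h2
    rw [h2]
    exact coeffMap_eq_self hE he (f x).2

/-- Every minimal right coideal has an injective envelope in `C`, onto which `C` retracts. -/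
theorem IsMinimalSubcomodule.exists_envelope {T : Submodule k C} (hT : IsMinimalSubcomodule k C T) :
    ∃ (E : Submodule k C) (_ : IsSubcomodule k C E) (e : C →ₗ[k] k), T ≤ E ∧
      (∀ X ≤ E, IsSubcomodule k C X → X ≠ ⊥ → T ≤ X) ∧
      (∀ x ∈ E, e x = Coalgebra.counit (R := k) x) ∧ LinearMap.range (coeffMap C e) = E := by
  -- `E` is a maximal essential extension of `T` inside `C`; as `T` is minimal, essentiality can be
  -- stated as `T ≤ X` for every nonzero subcomodule `X`.
  obtain ⟨E, hTE, hEmax⟩ := zorn_le_nonempty₀ {E : Submodule k C | IsSubcomodule k C E ∧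
      ∀ X ≤ E, IsSubcomodule k C X → X ≠ ⊥ → T ≤ X} (by
    intro c hc hchain y hy
    refine ⟨sSup c, ⟨IsSubcomodule.sSup fun X hX => (hc hX).1, fun X hX hXc h0 => ?_⟩,
      fun X hX => le_sSup hX⟩
    obtain ⟨x, hx, hx0⟩ := (Submodule.ne_bot_iff _).1 h0
    obtain ⟨Z, hZ, hxZ⟩ := (Submodule.mem_sSup_of_directed ⟨y, hy⟩ hchain.directedOn).1 (hX hx)
    exact ((hc hZ).2 (X ⊓ Z) inf_le_right (hXc.inf (hc hZ).1)
      ((Submodule.ne_bot_iff _).2 ⟨x, ⟨hx, hxZ⟩, hx0⟩)).trans inf_le_left) T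
    ⟨hT.1, fun X hX hXc h0 => (hT.2.2 X hX hXc h0).ge⟩
  obtain ⟨hE, hEess⟩ := hEmax.prop
  obtain ⟨K, hK, hKE, hKmax⟩ := exists_maximal_disjoint (IsSubcomodule k C)
    (fun S hS => IsSubcomodule.sSup hS) E
  obtain ⟨e, he1, he0⟩ := exists_functional_of_disjoint hKE (Coalgebra.counit (R := k) (A := C))
  have hg := isComoduleHom_coeffMap (C := C) e
  have hgE : ∀ x ∈ E, coeffMap C e x = x := fun x hx => coeffMap_eq_self hE he1 hx
  refine ⟨E, hE, e, hTE, hEess, he1, le_antisymm ?_ fun x hx => ⟨x, hgE x hx⟩⟩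
  -- The range contains `E`; once it is shown to be essential over `T`, maximality forces it to be
  -- `E`.
  refine hEmax.le_of_ge ⟨IsSubcomodule.range hg, fun X hX hXc h0 => ?_⟩ fun x hx => ⟨x, hgE x hx⟩
  -- The preimage of `X` contains `K`. If it missed `E`, maximality of `K` would make it equal to
  -- `K`, which is sent to zero, so that `X` would vanish.
  have hmeet : X.comap (coeffMap C e) ⊓ E ≠ ⊥ := by
    intro hbot
    have hle := hKmax _ (hXc.comap hg) (fun x hx => by
      rw [Submodule.mem_comap, coeffMap_eq_zero hK he0 hx]; exact zero_mem _) hbot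
    refine h0 ((Submodule.eq_bot_iff _).2 fun x hx => ?_)
    obtain ⟨z, rfl⟩ := hX hx
    exact coeffMap_eq_zero hK he0 (hle hx)
  obtain ⟨x, ⟨hxX, hxE⟩, hx0⟩ := (Submodule.ne_bot_iff _).1 hmeet
  rw [SetLike.mem_coe, Submodule.mem_comap, hgE x hxE] at hxX
  exact (hEess (X ⊓ E) inf_le_right (hXc.inf hE)
    ((Submodule.ne_bot_iff _).2 ⟨x, ⟨hxX, hxE⟩, hx0⟩)).trans inf_le_left

/-! ### Finite-rank functionals from semiperfectness -/

/-- The envelope of `T` found inside `C` is a retract of `C`, hence injective, so semiperfectness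
applies to it; the range of its retraction is the envelope itself. -/
theorem IsLeftSemiperfect.exists_functional_of_minimal (hC : IsLeftSemiperfect k C)
    {T : Submodule k C} (hT : IsMinimalSubcomodule k C T) : ∃ e : C →ₗ[k] k,
      (∀ x ∈ T, coeffMap C e x = x) ∧ (LinearMap.range (coeffMap C e)).FG := by
  obtain ⟨E, hE, e, hTE, hess, he, hrange⟩ := hT.exists_envelope
  let := hE.rightComodule
  let := hT.1.rightComodule
  refine ⟨e, fun x hx => coeffMap_eq_self hE he (hTE hx), ?_⟩
  rw [hrange, ← Module.Finite.iff_fg]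
  refine hC T E (Submodule.inclusion hTE) ⟨?_, fun X hX => ?_⟩ ⟨?_, ?_, ?_, fun X hX h0 => ?_⟩
  · exact Submodule.nontrivial_iff_ne_bot.2 hT.2.1
  · refine or_iff_not_imp_left.2 fun h0 => ?_
    have := hT.2.2 (X.map T.subtype) (Submodule.map_subtype_le T X)
      (hX.map hT.1.isComoduleHom_subtype)
      (fun h => h0 (Submodule.map_injective_of_injective T.subtype_injective
        (h.trans (Submodule.map_bot _).symm)))
    refine Submodule.map_injective_of_injective T.subtype_injective ?_
    rw [this, Submodule.map_top, Submodule.range_subtype]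
  · exact hE.isComoduleHom_of_subtype_comp _ hT.1.isComoduleHom_subtype
  · exact Submodule.inclusion_injective hTE
  · exact isInjectiveComodule_of_retract hE e he fun x => hrange ▸ ⟨x, rfl⟩
  · have hTX := hess (X.map E.subtype) (Submodule.map_subtype_le E X)
      (hX.map hE.isComoduleHom_subtype)
      (fun h => h0 (Submodule.map_injective_of_injective E.subtype_injective
        (h.trans (Submodule.map_bot _).symm)))
    obtain ⟨t, ht, ht0⟩ := (Submodule.ne_bot_iff _).1 hT.2.1
    obtain ⟨y, hy, hyt⟩ := hTX ht
    refine (Submodule.ne_bot_iff _).2 ⟨y, ⟨hy, ⟨t, ht⟩, Subtype.ext hyt.symm⟩, fun h => ht0 ?_⟩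
    rw [← hyt, h, map_zero]

/-- Among functionals `f` acting with finite rank, take one for which `ε - f` has the smallest image
of `D`. If that image were nonzero, it would contain a minimal right coideal, and the functional
fixing the latter would correct `f` to a better one. -/
theorem IsLeftSemiperfect.exists_functional (hC : IsLeftSemiperfect k C) {D : Submodule k C}
    (hD : IsSubcomodule k C D) (hfg : D.FG) : ∃ e : C →ₗ[k] k,
      (∀ x ∈ D, e x = Coalgebra.counit (R := k) x) ∧ (LinearMap.range (coeffMap C e)).FG := by
  classical
  let P : ℕ → Prop := fun n => ∃ f : C →ₗ[k] k, (LinearMap.range (coeffMap C f)).FG ∧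
    Module.finrank k (D.map (coeffMap C (Coalgebra.counit - f))) = n
  have hex : ∃ n, P n := by
    refine ⟨_, 0, ?_, rfl⟩
    rw [(coeffMap_eq_zero_iff (C := C) (0 : C →ₗ[k] k)).2 rfl, LinearMap.range_zero]
    exact Submodule.fg_bot
  obtain ⟨f, hf, hn⟩ := Nat.find_spec hex
  set ψ := coeffMap C (Coalgebra.counit - f) with hψ
  have hψh : IsComoduleHom k C ψ := isComoduleHom_coeffMap _
  by_cases h0 : D.map ψ = ⊥
  · refine ⟨f, fun x hx => ?_, hf⟩
    have h1 : ψ x ∈ D.map ψ := ⟨x, hx, rfl⟩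
    rw [h0, Submodule.mem_bot] at h1
    have h2 := counit_coeffMap (C := C) (Coalgebra.counit (R := k) - f) x
    rw [← hψ, h1, map_zero, LinearMap.sub_apply] at h2
    exact (sub_eq_zero.1 h2.symm).symm
  exfalso
  obtain ⟨T, hTle, hT⟩ := exists_isMinimalSubcomodule_le (hfg.map ψ) (hD.map hψh) h0
  obtain ⟨e, heT, he⟩ := hC.exists_functional_of_minimal hT
  -- Chosen so that `ε - f'` acts as `ψ` followed by `1 - e`: the new image of `D` is a quotient of
  -- the old one, and `T` dies in it.
  set f' := f + e ∘ₗ ψ with hf'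
  have hcomp : coeffMap C (e ∘ₗ ψ) = coeffMap C e ∘ₗ ψ := (coeffMap_comp hψh e).symm
  have hfd : FiniteDimensional k (D.map ψ) := Module.Finite.iff_fg.2 (hfg.map ψ)
  have hψ' : coeffMap C (Coalgebra.counit - f') = (LinearMap.id - coeffMap C e) ∘ₗ ψ := by
    rw [hf', ← sub_sub, coeffMap_sub, ← hψ, hcomp]
    rfl
  have hrange' : (LinearMap.range (coeffMap C f')).FG := by
    refine (hf.sup he).of_le' ?_
    rintro _ ⟨x, rfl⟩
    rw [hf', coeffMap_add, hcomp]
    exact Submodule.add_mem_sup ⟨x, rfl⟩ ⟨ψ x, rfl⟩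
  have hlt : Module.finrank k (D.map (coeffMap C (Coalgebra.counit - f'))) < Nat.find hex := by
    rw [← hn, hψ', Submodule.map_comp]
    set q := (LinearMap.id - coeffMap C e).domRestrict (D.map ψ) with hq
    have hr : (D.map ψ).map (LinearMap.id - coeffMap C e) = LinearMap.range q := by
      rw [hq, LinearMap.range_domRestrict]
    rw [hr, ← LinearMap.finrank_range_add_finrank_ker q]
    refine Nat.lt_add_of_pos_right ?_
    obtain ⟨t, ht, ht0⟩ := (Submodule.ne_bot_iff _).1 hT.2.1
    have : Nontrivial (LinearMap.ker q) := by
      refine Submodule.nontrivial_iff_ne_bot.2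
        ((Submodule.ne_bot_iff _).2 ⟨⟨t, hTle ht⟩, ?_, fun h => ht0 (congrArg Subtype.val h)⟩)
      change t - coeffMap C e t = 0
      rw [heT t ht, sub_self]
    exact Module.finrank_pos
  exact Nat.find_min hex hlt ⟨f', hrange', rfl⟩

theorem IsSimpleSubcoalgebra.fg {D : Submodule k C} (hD : IsSimpleSubcoalgebra k D) : D.FG := by
  obtain ⟨d, hd, h0⟩ := D.ne_bot_iff.1 hD.2.1
  obtain ⟨X, hXfg, hX, hdX⟩ := exists_fg_subcomodule (k := k) (C := C) d
  rcases hD.2.2 _ (hD.1.inf (isSubcoalgebra_coefficientSpan hX)) inf_le_left with h | h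
  · exact absurd ((Submodule.eq_bot_iff _).1 h d ⟨hd, le_coefficientSpan X hdX⟩) h0
  · exact (fg_coefficientSpan hXfg).of_le' (inf_eq_left.1 h)

/-- Since `ε - e` vanishes on `D`, it moves `D ∧ Cₙ₋₁` into `Cₙ₋₁`. Hence each `x` there is
congruent to its image under the finite-rank action of `e`. -/
theorem IsLeftSemiperfect.isLoewyFinite (hC : IsLeftSemiperfect k C) : IsLoewyFinite k C := by
  intro D hD
  obtain ⟨e, he, hfg⟩ := hC.exists_functional hD.1.isSubcomodule hD.fg
  have hdiff : ∀ n, ∀ x ∈ wedge k D (coradicalFiltrationPred k C n),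
      x - coeffMap C e x ∈ coradicalFiltrationPred k C n := by
    intro n x hx
    rw [mem_wedge_iff_coeffMap] at hx
    have := hx (Coalgebra.counit - e) fun a ha => by
      rw [LinearMap.sub_apply, he a ha, sub_self]
    rwa [coeffMap_sub, LinearMap.sub_apply, coeffMap_counit] at this
  constructor
  · intro n
    refine (hfg.map (coradicalFiltrationPred k C n).mkQ).of_le' ?_
    rintro _ ⟨x, hx, rfl⟩
    exact ⟨coeffMap C e x, ⟨x, rfl⟩, ((Submodule.Quotient.eq _).2 (hdiff n x hx)).symm⟩
  -- The filtration is exhaustive, so the finite-dimensional range of the action of `e` lies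
  -- entirely in step `N`.
  · obtain ⟨N, hN⟩ := eventually_const_of_fg hfg (coradicalFiltrationPred_mono (k := k) (C := C))
    refine ⟨N, fun n hn x hx => ?_⟩
    obtain ⟨m, hm⟩ := exists_mem_coradicalFiltrationPred (k := k) (coeffMap C e x)
    have h1 : coeffMap C e x ∈ coradicalFiltrationPred k C n := by
      have h2 : coeffMap C e x ∈ LinearMap.range (coeffMap C e) ⊓
          coradicalFiltrationPred k C (max m N) :=
        ⟨⟨x, rfl⟩, coradicalFiltrationPred_mono (le_max_left m N) hm⟩
      rw [hN _ (le_max_right m N), ← hN n hn] at h2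
      exact h2.2
    have := add_mem (hdiff n x hx) h1
    rwa [sub_add_cancel] at this

theorem isLeftSemiperfect_iff_isLoewyFinite : IsLeftSemiperfect k C ↔ IsLoewyFinite k C :=
  ⟨IsLeftSemiperfect.isLoewyFinite, IsLoewyFinite.isLeftSemiperfect⟩

end Criterion

/-! ### Linear maps injective on a subspace -/

section

variable {k : Type u} {G C : Type v} [Field k] [AddCommGroup G] [Module k G]
  [AddCommGroup C] [Module k C] {r : G →ₗ[k] C} {F : Submodule k G}

theorem exists_functional_comp_eq {F : Submodule k G} (hF : F ⊓ LinearMap.ker r = ⊥)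
    (f : G →ₗ[k] k) : ∃ f' : C →ₗ[k] k, ∀ x ∈ F, f x = (f' ∘ₗ r) x := by
  have hker : LinearMap.ker (r ∘ₗ F.subtype) = ⊥ :=
    (Submodule.eq_bot_iff _).2 fun x hx =>
      Subtype.ext ((Submodule.eq_bot_iff _).1 hF _ ⟨x.2, hx⟩)
  obtain ⟨l, hl⟩ := LinearMap.exists_leftInverse_of_injective _ hker
  refine ⟨f ∘ₗ F.subtype ∘ₗ l, fun x hx => ?_⟩
  have := LinearMap.congr_fun hl ⟨x, hx⟩
  simp only [LinearMap.comp_apply, Submodule.subtype_apply, LinearMap.id_apply] at this ⊢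
  rw [this]

theorem map_comap_inf {Z : Submodule k C} (hZ : Z ≤ F.map r) : (Z.comap r ⊓ F).map r = Z := by
  refine le_antisymm ?_ fun z hz => ?_
  · rintro _ ⟨x, hx, rfl⟩
    exact hx.1
  · obtain ⟨x, hx, rfl⟩ := hZ hz
    exact ⟨x, ⟨hz, hx⟩, rfl⟩

theorem map_eq_bot_of_inf_ker (hinj : F ⊓ LinearMap.ker r = ⊥) {X : Submodule k G} (hX : X ≤ F)
    (h : X.map r = ⊥) : X = ⊥ :=
  (Submodule.eq_bot_iff _).2 fun x hx => (Submodule.eq_bot_iff _).1 hinj x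
    ⟨hX hx, (Submodule.eq_bot_iff _).1 h _ ⟨x, hx, rfl⟩⟩

theorem comap_map_inf (hinj : F ⊓ LinearMap.ker r = ⊥) {X : Submodule k G} (hX : X ≤ F) :
    (X.map r).comap r ⊓ F = X := by
  refine le_antisymm ?_ fun x hx => ⟨⟨x, hx, rfl⟩, hX hx⟩
  rintro x ⟨⟨y, hy, hyx⟩, hx⟩
  have := (Submodule.eq_bot_iff _).1 hinj (y - x)
    ⟨sub_mem (hX hy) hx, LinearMap.mem_ker.2 (by rw [map_sub, hyx, sub_self])⟩
  rwa [← sub_eq_zero.1 this]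

end

/-! ### Comultiplicative maps and simple subcoalgebras -/

section ComulMap

variable {k : Type u} {G C : Type v} [Field k] [AddCommGroup G] [Module k G] [Coalgebra k G]
  [AddCommGroup C] [Module k C] [Coalgebra k C]

/-- A linear map that commutes with the comultiplications. -/
def IsComulMap (r : G →ₗ[k] C) : Prop :=
  ∀ x, Coalgebra.comul (R := k) (r x) = TensorProduct.map r r (Coalgebra.comul x)

variable {r : G →ₗ[k] C}

theorem IsComulMap.coeffMap_map (hr : IsComulMap r) (f : C →ₗ[k] k) (x : G) :
    coeffMap C f (r x) = r (coeffMap G (f ∘ₗ r) x) := by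
  change sliceLeft C f (Coalgebra.comul (r x)) = _
  rw [hr, sliceLeft_map]
  rfl

theorem IsComulMap.coactBy_map (hr : IsComulMap r) (f : C →ₗ[k] k) (x : G) :
    coactBy C f (r x) = r (coactBy G (f ∘ₗ r) x) := by
  change sliceRight C f (Coalgebra.comul (r x)) = _
  rw [hr, sliceRight_map]
  rfl

theorem IsComulMap.isSubcoalgebra_map (hr : IsComulMap r) {D : Submodule k G}
    (hD : IsSubcoalgebra k D) : IsSubcoalgebra k (D.map r) := by
  rw [isSubcoalgebra_iff] at *
  rintro f _ ⟨x, hx, rfl⟩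
  rw [hr.coeffMap_map, hr.coactBy_map]
  exact ⟨⟨_, (hD _ x hx).1, rfl⟩, ⟨_, (hD _ x hx).2, rfl⟩⟩

variable {F : Submodule k G}

/-- Stability is needed under all functionals on `G`, while `r` only intertwines those pulled back
from `C`. As `r` is injective on `F`, every functional agrees on `F` with a pulled-back one. -/
theorem IsComulMap.isSubcoalgebra_comap_inf (hr : IsComulMap r) (hF : IsSubcoalgebra k F)
    (hinj : F ⊓ LinearMap.ker r = ⊥) {Z : Submodule k C} (hZ : IsSubcoalgebra k Z) :
    IsSubcoalgebra k (Z.comap r ⊓ F) := by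
  rw [isSubcoalgebra_iff] at hZ ⊢
  rintro f x ⟨hxZ, hxF⟩
  have hF' := (isSubcoalgebra_iff F).1 hF f x hxF
  obtain ⟨f', hf'⟩ := exists_functional_comp_eq hinj f
  refine ⟨⟨?_, hF'.1⟩, ⟨?_, hF'.2⟩⟩
  · change r (coactBy G f x) ∈ Z
    rw [hF.coactBy_congr hf' hxF, ← hr.coactBy_map]
    exact (hZ f' _ hxZ).1
  · change r (coeffMap G f x) ∈ Z
    rw [coeffMap_congr hF.isSubcomodule hf' hxF, ← hr.coeffMap_map]
    exact (hZ f' _ hxZ).2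

/-- Image and preimage are inverse bijections between the subcoalgebras inside `F` and those inside
`F.map r`, so simplicity passes across. -/
theorem IsSimpleSubcoalgebra.map (hr : IsComulMap r) (hF : IsSubcoalgebra k F)
    (hinj : F ⊓ LinearMap.ker r = ⊥) {D : Submodule k G} (hD : IsSimpleSubcoalgebra k D)
    (hDF : D ≤ F) : IsSimpleSubcoalgebra k (D.map r) := by
  refine ⟨hr.isSubcoalgebra_map hD.1, fun h => hD.2.1 (map_eq_bot_of_inf_ker hinj hDF h),
    fun Z hZ hle => ?_⟩
  have hZF : (Z.comap r ⊓ F).map r = Z := map_comap_inf (hle.trans (Submodule.map_mono hDF))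
  have h := hD.2.2 _ (hr.isSubcoalgebra_comap_inf hF hinj hZ)
    ((inf_le_inf_right F (Submodule.comap_mono hle)).trans (comap_map_inf hinj hDF).le)
  rw [← hZF]
  exact h.imp (fun h => by rw [h, Submodule.map_bot]) fun h => by rw [h]

theorem IsSimpleSubcoalgebra.comap (hr : IsComulMap r) (hF : IsSubcoalgebra k F)
    (hinj : F ⊓ LinearMap.ker r = ⊥) {D : Submodule k C} (hD : IsSimpleSubcoalgebra k D)
    (hDF : D ≤ F.map r) : IsSimpleSubcoalgebra k (D.comap r ⊓ F) := by
  refine ⟨hr.isSubcoalgebra_comap_inf hF hinj hD.1, fun h => hD.2.1 ?_, fun Z hZ hle => ?_⟩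
  · rw [← map_comap_inf hDF, h, Submodule.map_bot]
  · have hZF : Z ≤ F := hle.trans inf_le_right
    rw [← comap_map_inf hinj hZF]
    refine (hD.2.2 _ (hr.isSubcoalgebra_map hZ) ?_).imp (fun h => ?_) fun h => by rw [h]
    · rintro _ ⟨x, hx, rfl⟩
      exact (hle hx).1
    · rw [comap_map_inf hinj hZF]
      exact map_eq_bot_of_inf_ker hinj hZF h

end ComulMap

/-! ### The grading filtration of the associated graded coalgebra -/

section GrFiltration

variable {k : Type u} {C : Type v} [Field k] [AddCommGroup C] [Module k C] [Coalgebra k C]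

/-- The reverse of `coradicalFiltrationPred_add_le`, again by associativity of the wedge. The
resulting equality is what makes the degree filtration of `gr C` a wedge filtration. -/
theorem wedge_coradicalFiltrationPred_le (i j : ℕ) :
    wedge k (coradicalFiltrationPred k C i) (coradicalFiltrationPred k C j) ≤
      coradicalFiltrationPred k C (i + j) := by
  induction j with
  | zero => exact wedge_bot_right_le _
  | succ j ih =>
    rw [coradicalFiltrationPred_succ, ← wedge_assoc, ← add_assoc, coradicalFiltrationPred_succ]
    exact wedge_mono ih le_rfl

theorem map_eq_zero_of_mkQ_map {V W V' W' : Type*} [AddCommGroup V] [Module k V]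
    [AddCommGroup W] [Module k W] [AddCommGroup V'] [Module k V'] [AddCommGroup W'] [Module k W']
    {X : Submodule k V} {Y : Submodule k W} {p : V →ₗ[k] V'} {q : W →ₗ[k] W'}
    (hp : X ≤ LinearMap.ker p) (hq : Y ≤ LinearMap.ker q) {t : V ⊗[k] W}
    (ht : TensorProduct.map X.mkQ Y.mkQ t = 0) : TensorProduct.map p q t = 0 := by
  rw [← Submodule.liftQ_mkQ X p hp, ← Submodule.liftQ_mkQ Y q hq, TensorProduct.map_comp,
    LinearMap.comp_apply, ht, map_zero]

variable (k C) in
/-- The projection of `gr C` to its component of degree `n`, with values in `C / Cₙ₋₁`. -/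
noncomputable def Gr.proj (n : ℕ) : Gr k C →ₗ[k] C ⧸ coradicalFiltrationPred k C n :=
  (grComponent k C n).subtype ∘ₗ DirectSum.component k ℕ (fun n => grComponent k C n) n

theorem Gr.proj_comp_of_self (n : ℕ) :
    Gr.proj k C n ∘ₗ Gr.of k C n = (grComponent k C n).subtype := by
  ext1 y
  exact congrArg Subtype.val
    (DirectSum.component.lof_self (M := fun n => grComponent k C n) k n y)

theorem Gr.proj_comp_of_of_ne {m n : ℕ} (h : m ≠ n) : Gr.proj k C m ∘ₗ Gr.of k C n = 0 := by
  ext1 y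
  refine congrArg Subtype.val (?_ : DirectSum.component k ℕ (fun n => grComponent k C n) m
    (DirectSum.lof k ℕ (fun n => grComponent k C n) n y) = 0)
  rw [DirectSum.component.of, dif_neg (Ne.symm h)]

theorem Gr.proj_of_self (n : ℕ) (y : grComponent k C n) : Gr.proj k C n (Gr.of k C n y) = y.1 :=
  LinearMap.congr_fun (Gr.proj_comp_of_self n) y

theorem Gr.proj_of_of_ne {m n : ℕ} (h : m ≠ n) (y : grComponent k C n) :
    Gr.proj k C m (Gr.of k C n y) = 0 :=
  LinearMap.congr_fun (Gr.proj_comp_of_of_ne h) y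

theorem Gr.proj_mem (n : ℕ) (x : Gr k C) : Gr.proj k C n x ∈ grComponent k C n :=
  Subtype.prop _

theorem Gr.eq_zero_of_proj (x : Gr k C) (h : ∀ n, Gr.proj k C n x = 0) : x = 0 :=
  DirectSum.ext_component k fun n => Subtype.ext (h n)

/-- The bihomogeneous components of the comultiplication of `gr C`. -/
theorem Gr.map_proj_comul {i j n : ℕ} (h : i + j = n) (x : Gr k C) :
    TensorProduct.map (Gr.proj k C i) (Gr.proj k C j) (Coalgebra.comul x) =
      quotComul h (Gr.proj k C n x) := by
  refine LinearMap.congr_fun (f := TensorProduct.map (Gr.proj k C i) (Gr.proj k C j) ∘ₗ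
    Coalgebra.comul) (g := quotComul h ∘ₗ Gr.proj k C n) (Gr.hom_ext fun m y => ?_) x
  rw [LinearMap.comp_apply, LinearMap.comp_apply, Gr.comul_of, map_sum]
  have hpart : ∀ p ∈ Finset.HasAntidiagonal.antidiagonal m, p ≠ (i, j) →
      TensorProduct.map (Gr.proj k C i) (Gr.proj k C j) (Gr.comulPart m p.1 p.2 y) = 0 := by
    rintro ⟨a, b⟩ hp hne
    rw [Gr.comulPart_of_add_eq (Finset.HasAntidiagonal.mem_antidiagonal.1 hp),
      ← LinearMap.comp_apply, ← LinearMap.comp_assoc, ← TensorProduct.map_comp]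
    by_cases ha : i = a
    · have hb : j ≠ b := fun hb => hne (by rw [ha, hb])
      rw [Gr.proj_comp_of_of_ne hb, TensorProduct.map_zero_right, LinearMap.zero_comp,
        LinearMap.zero_apply]
    · rw [Gr.proj_comp_of_of_ne ha, TensorProduct.map_zero_left, LinearMap.zero_comp,
        LinearMap.zero_apply]
  by_cases hm : m = n
  · subst hm
    rw [Finset.sum_eq_single (i, j) hpart
      fun hn => absurd (Finset.HasAntidiagonal.mem_antidiagonal.2 h) hn,
      Gr.comulPart_of_add_eq h, ← LinearMap.comp_apply, ← LinearMap.comp_assoc,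
      ← TensorProduct.map_comp, Gr.proj_comp_of_self, Gr.proj_comp_of_self, Gr.proj_of_self]
    exact grTensorIncl_grComulComponent h y
  · rw [Gr.proj_of_of_ne (Ne.symm hm), map_zero]
    refine Finset.sum_eq_zero fun p hp => hpart p hp ?_
    rintro rfl
    exact hm ((Finset.HasAntidiagonal.mem_antidiagonal.1 hp).symm.trans h)

variable (k C) in
/-- The part of `gr C` of degree less than `n`. -/
noncomputable def Gr.degreeLT (n : ℕ) : Submodule k (Gr k C) :=
  ⨅ m, ⨅ (_ : n ≤ m), LinearMap.ker (Gr.proj k C m)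

theorem Gr.mem_degreeLT {n : ℕ} {x : Gr k C} :
    x ∈ Gr.degreeLT k C n ↔ ∀ m, n ≤ m → Gr.proj k C m x = 0 := by
  simp [Gr.degreeLT, Submodule.mem_iInf]

theorem Gr.degreeLT_zero : Gr.degreeLT k C 0 = ⊥ :=
  (Submodule.eq_bot_iff _).2 fun x hx =>
    Gr.eq_zero_of_proj x fun n => Gr.mem_degreeLT.1 hx n n.zero_le

theorem Gr.of_mem_degreeLT {m n : ℕ} (h : m < n) (y : grComponent k C m) :
    Gr.of k C m y ∈ Gr.degreeLT k C n :=
  Gr.mem_degreeLT.2 fun l hl => Gr.proj_of_of_ne (by omega) y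

theorem Gr.degreeLT_le {n : ℕ} {P : Submodule k (Gr k C)}
    (h : ∀ m < n, ∀ y, Gr.of k C m y ∈ P) : Gr.degreeLT k C n ≤ P := by
  classical
  intro x hx
  have hsum : (∑ i ∈ DFinsupp.support (β := fun n => grComponent k C n) x,
      Gr.of k C i (DirectSum.component k ℕ (fun n => grComponent k C n) i x)) = x :=
    DirectSum.sum_support_of (β := fun n => grComponent k C n) x
  rw [← hsum]
  refine sum_mem fun i _ => ?_
  by_cases hi : i < n
  · exact h i hi _
  · have : DirectSum.component k ℕ (fun n => grComponent k C n) i x = 0 :=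
      Subtype.ext (Gr.mem_degreeLT.1 hx i (not_lt.1 hi))
    rw [this, map_zero]
    exact zero_mem _

theorem Gr.exists_mem_degreeLT (x : Gr k C) : ∃ n, x ∈ Gr.degreeLT k C n := by
  classical
  refine ⟨(DFinsupp.support (β := fun n => grComponent k C n) x).sup id + 1,
    Gr.mem_degreeLT.2 fun m hm => ?_⟩
  by_contra hne
  have hmem : m ∈ DFinsupp.support (β := fun n => grComponent k C n) x :=
    DFinsupp.mem_support_iff.2 fun h0 => hne (congrArg Subtype.val h0)
  have := Finset.le_sup (f := id) hmem
  simp only [id] at this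
  omega

theorem Gr.degreeLT_add_le (a b : ℕ) :
    Gr.degreeLT k C (a + b) ≤ wedge k (Gr.degreeLT k C a) (Gr.degreeLT k C b) := by
  refine Gr.degreeLT_le fun m hm y => ?_
  rw [mem_wedge_iff, Gr.comul_of, map_sum]
  refine Finset.sum_eq_zero fun p hp => ?_
  have hp' := Finset.HasAntidiagonal.mem_antidiagonal.1 hp
  rw [Gr.comulPart_of_add_eq hp', ← LinearMap.comp_apply, ← LinearMap.comp_assoc,
    ← TensorProduct.map_comp]
  have hz : ∀ {i n : ℕ}, i < n → (Gr.degreeLT k C n).mkQ ∘ₗ Gr.of k C i = 0 := fun h =>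
    LinearMap.ext fun z => (Submodule.Quotient.mk_eq_zero _).2 (Gr.of_mem_degreeLT h z)
  rcases (by omega : p.1 < a ∨ p.2 < b) with h | h
  · rw [hz h, TensorProduct.map_zero_left, LinearMap.zero_comp, LinearMap.zero_apply]
  · rw [hz h, TensorProduct.map_zero_right, LinearMap.zero_comp, LinearMap.zero_apply]

/-- For `m = a + j` with `j ≥ b`, the component of `Δ x` in bidegree `(a, j)` vanishes. A
representative `c` of the degree `m` part of `x` then lies in `Cₐ₋₁ ∧ Cⱼ₋₁ ⊆ Cₘ₋₁`, so that part is
zero. -/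
theorem Gr.wedge_degreeLT_le (a b : ℕ) :
    wedge k (Gr.degreeLT k C a) (Gr.degreeLT k C b) ≤ Gr.degreeLT k C (a + b) := by
  intro x hx
  refine Gr.mem_degreeLT.2 fun m hm => ?_
  obtain ⟨j, rfl⟩ : ∃ j, m = a + j := ⟨m - a, by omega⟩
  have h := map_eq_zero_of_mkQ_map (p := Gr.proj k C a) (q := Gr.proj k C j)
    (fun y hy => Gr.mem_degreeLT.1 hy a le_rfl)
    (fun y hy => Gr.mem_degreeLT.1 hy j (by omega)) ((mem_wedge_iff _ _ x).1 hx)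
  rw [Gr.map_proj_comul rfl] at h
  obtain ⟨c, hc⟩ := Submodule.mkQ_surjective _ (Gr.proj k C (a + j) x)
  rw [← hc, ← LinearMap.comp_apply, quotComul_comp_mkQ] at h
  rw [← hc]
  exact (Submodule.Quotient.mk_eq_zero _).2
    (wedge_coradicalFiltrationPred_le a j ((mem_wedge_iff _ _ c).2 h))

theorem Gr.isSubcoalgebra_degreeLT (n : ℕ) : IsSubcoalgebra k (Gr.degreeLT k C n) := by
  rw [isSubcoalgebra_iff]
  intro f x hx
  constructor
  · refine (mem_wedge_iff_coactBy _ ⊥ x).1 ?_ f fun y hy => ?_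
    · have := Gr.degreeLT_add_le n 0 hx
      rwa [Gr.degreeLT_zero] at this
    · rw [(Submodule.mem_bot k).1 hy, map_zero]
  · refine (mem_wedge_iff_coeffMap ⊥ _ x).1 ?_ f fun y hy => ?_
    · rw [← zero_add n] at hx
      have := Gr.degreeLT_add_le 0 n hx
      rwa [Gr.degreeLT_zero] at this
    · rw [(Submodule.mem_bot k).1 hy, map_zero]

/-- Otherwise `D` misses degree zero, and a functional equal to `ε` on `D` and zero in degree zero
acts on `D` both as the identity and by lowering the degree, which forces `D = 0`. -/
theorem Gr.simple_le_degreeLT_one {D : Submodule k (Gr k C)} (hD : IsSimpleSubcoalgebra k D) :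
    D ≤ Gr.degreeLT k C 1 := by
  rcases hD.2.2 _ (hD.1.inf (Gr.isSubcoalgebra_degreeLT 1)) inf_le_left with h | h
  · obtain ⟨e, he1, he0⟩ := exists_functional_of_disjoint ((inf_comm _ _).trans h)
      (Coalgebra.counit (R := k) (A := Gr k C))
    have key : ∀ n, ∀ x ∈ D, x ∈ Gr.degreeLT k C n → x = 0 := by
      intro n
      induction n with
      | zero => exact fun x _ hx => by rwa [Gr.degreeLT_zero, Submodule.mem_bot] at hx
      | succ n ih =>
        intro x hxD hx
        refine ih x hxD ?_
        rw [add_comm] at hx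
        have := (mem_wedge_iff_coeffMap _ _ x).1 (Gr.degreeLT_add_le 1 n hx) e he0
        rwa [coeffMap_eq_self hD.1.isSubcomodule he1 hxD] at this
    refine absurd ((Submodule.eq_bot_iff _).2 fun x hx => ?_) hD.2.1
    obtain ⟨n, hn⟩ := Gr.exists_mem_degreeLT x
    exact key n x hx hn
  · exact inf_eq_left.1 h

variable (k C) in
/-- The projection of `gr C` to `C₀ ⊆ C`. -/
noncomputable def Gr.toCoradical : Gr k C →ₗ[k] C :=
  (Submodule.quotEquivOfEqBot (coradicalFiltrationPred k C 0) rfl).toLinearMap ∘ₗ Gr.proj k C 0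

theorem Gr.isComulMap_toCoradical : IsComulMap (Gr.toCoradical k C) := by
  intro x
  obtain ⟨c, hc⟩ := Submodule.mkQ_surjective _ (Gr.proj k C 0 x)
  have hs : (Submodule.quotEquivOfEqBot (coradicalFiltrationPred k C 0) rfl).toLinearMap ∘ₗ
      (coradicalFiltrationPred k C 0).mkQ = LinearMap.id := LinearMap.ext fun _ => rfl
  have h := Gr.map_proj_comul (zero_add 0) x
  rw [Gr.toCoradical, TensorProduct.map_comp, LinearMap.comp_apply, LinearMap.comp_apply, h, ← hc,
    ← LinearMap.comp_apply (quotComul _), quotComul_comp_mkQ, LinearMap.comp_apply,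
    ← LinearMap.comp_apply (TensorProduct.map _ _), ← TensorProduct.map_comp, hs,
    TensorProduct.map_id]
  rfl

theorem Gr.mkQ_toCoradical (x : Gr k C) :
    (coradicalFiltrationPred k C 0).mkQ (Gr.toCoradical k C x) = Gr.proj k C 0 x :=
  (Submodule.quotEquivOfEqBot (coradicalFiltrationPred k C 0) rfl).symm_apply_apply _

theorem Gr.toCoradical_of_mk (c : coradicalFiltration k C 0) :
    Gr.toCoradical k C (Gr.of k C 0 (Gr.mk k C 0 c)) = c := by
  rw [Gr.toCoradical, LinearMap.comp_apply, Gr.proj_of_self]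
  rfl

theorem Gr.degreeLT_one_inf_ker : Gr.degreeLT k C 1 ⊓ LinearMap.ker (Gr.toCoradical k C) = ⊥ := by
  refine (Submodule.eq_bot_iff _).2 fun x hx => Gr.eq_zero_of_proj x fun n => ?_
  cases n with
  | zero => rw [← Gr.mkQ_toCoradical, LinearMap.mem_ker.1 hx.2, map_zero]
  | succ n => exact Gr.mem_degreeLT.1 hx.1 _ (by omega)

theorem Gr.map_toCoradical : (Gr.degreeLT k C 1).map (Gr.toCoradical k C) = coradical k C := by
  refine le_antisymm ?_ fun c hc => ?_
  · rintro _ ⟨x, -, rfl⟩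
    obtain ⟨c, hc, hcx⟩ := Gr.proj_mem 0 x
    have : Gr.toCoradical k C x = c := by
      rw [Gr.toCoradical, LinearMap.comp_apply, ← hcx]
      rfl
    rw [this]
    exact hc
  · exact ⟨_, Gr.of_mem_degreeLT one_pos _, Gr.toCoradical_of_mk ⟨c, hc⟩⟩

theorem Gr.simple_map {D : Submodule k (Gr k C)} (hD : IsSimpleSubcoalgebra k D) :
    IsSimpleSubcoalgebra k (D.map (Gr.toCoradical k C)) :=
  hD.map Gr.isComulMap_toCoradical (Gr.isSubcoalgebra_degreeLT 1) Gr.degreeLT_one_inf_ker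
    (Gr.simple_le_degreeLT_one hD)

theorem Gr.exists_simple_map_eq {D : Submodule k C} (hD : IsSimpleSubcoalgebra k D) :
    ∃ D' : Submodule k (Gr k C), IsSimpleSubcoalgebra k D' ∧ D'.map (Gr.toCoradical k C) = D := by
  have hle : D ≤ (Gr.degreeLT k C 1).map (Gr.toCoradical k C) := by
    rw [Gr.map_toCoradical]
    exact le_sSup hD
  exact ⟨_, hD.comap Gr.isComulMap_toCoradical (Gr.isSubcoalgebra_degreeLT 1)
    Gr.degreeLT_one_inf_ker hle, map_comap_inf hle⟩

/-- Every simple subcoalgebra of `C` is the image of one of `gr C`, so the coradical of `gr C` maps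
onto `C₀`; the degree zero part does so injectively. -/
theorem Gr.coradical_eq : coradical k (Gr k C) = Gr.degreeLT k C 1 := by
  refine le_antisymm (sSup_le fun D hD => Gr.simple_le_degreeLT_one hD) fun x hx => ?_
  have hle : coradical k C ≤ (coradical k (Gr k C)).map (Gr.toCoradical k C) :=
    sSup_le fun D hD => by
      obtain ⟨D', hD', rfl⟩ := Gr.exists_simple_map_eq hD
      exact Submodule.map_mono (le_sSup hD')
  rw [← Gr.map_toCoradical] at hle
  have hcor : coradical k (Gr k C) ≤ Gr.degreeLT k C 1 :=
    sSup_le fun D hD => Gr.simple_le_degreeLT_one hD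
  rw [← comap_map_inf Gr.degreeLT_one_inf_ker hcor]
  exact ⟨hle ⟨x, hx, rfl⟩, hx⟩

/-- The coradical filtration of `gr C` is the one defined by the grading. -/
theorem Gr.coradicalFiltrationPred_eq (n : ℕ) :
    coradicalFiltrationPred k (Gr k C) n = Gr.degreeLT k C n := by
  induction n with
  | zero => exact Gr.degreeLT_zero.symm
  | succ n ih =>
    rw [coradicalFiltrationPred_succ, ih, Gr.coradical_eq]
    exact le_antisymm (Gr.wedge_degreeLT_le n 1) (Gr.degreeLT_add_le n 1)

/-! ### Comparison of the layers of `C` and `gr C` -/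

theorem Gr.wedge_simple_le {D : Submodule k (Gr k C)} (hD : IsSimpleSubcoalgebra k D) (n : ℕ) :
    wedge k D (Gr.degreeLT k C n) ≤ Gr.degreeLT k C (n + 1) := by
  rw [add_comm]
  exact (wedge_mono (Gr.simple_le_degreeLT_one hD) le_rfl).trans (Gr.wedge_degreeLT_le 1 n)

/-- The bridge between the two criteria: modulo lower terms, both wedge conditions concern only the
component of `Δ` in bidegree `(0, n)`, which is the same for `x` and for a representative `c`. -/
theorem Gr.map_proj_wedge {D : Submodule k (Gr k C)} (hD : IsSimpleSubcoalgebra k D) (n : ℕ) :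
    (wedge k D (Gr.degreeLT k C n)).map (Gr.proj k C n) =
      (wedge k (D.map (Gr.toCoradical k C)) (coradicalFiltrationPred k C n)).map
        (coradicalFiltrationPred k C n).mkQ := by
  have hs : (Submodule.quotEquivOfEqBot (coradicalFiltrationPred k C 0) rfl).toLinearMap ∘ₗ
      (coradicalFiltrationPred k C 0).mkQ = LinearMap.id := LinearMap.ext fun _ => rfl
  -- The two sides of the comultiplication, in terms of a representative `c` of `projₙ x`.
  have hcomul : ∀ (x : Gr k C) (c : C), (coradicalFiltrationPred k C n).mkQ c = Gr.proj k C n x →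
      TensorProduct.map (Gr.toCoradical k C) (Gr.proj k C n) (Coalgebra.comul x) =
        TensorProduct.map LinearMap.id (coradicalFiltrationPred k C n).mkQ
          (Coalgebra.comul (R := k) c) := by
    intro x c hc
    have h := Gr.map_proj_comul (zero_add n) x
    rw [← hc, ← LinearMap.comp_apply (quotComul _), quotComul_comp_mkQ] at h
    have h' := congrArg (LinearMap.rTensor _
      (Submodule.quotEquivOfEqBot (coradicalFiltrationPred k C 0) rfl).toLinearMap) h
    rw [← LinearMap.comp_apply, LinearMap.rTensor_comp_map, LinearMap.comp_apply,
      ← LinearMap.comp_apply (LinearMap.rTensor _ _), LinearMap.rTensor_comp_map, hs] at h'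
    exact h'
  refine le_antisymm ?_ ?_
  · rintro _ ⟨x, hx, rfl⟩
    obtain ⟨c, hc⟩ := Submodule.mkQ_surjective _ (Gr.proj k C n x)
    refine ⟨c, ?_, hc⟩
    have h1 := map_eq_zero_of_mkQ_map
      (p := (D.map (Gr.toCoradical k C)).mkQ ∘ₗ Gr.toCoradical k C) (q := Gr.proj k C n)
      (fun y hy => (Submodule.Quotient.mk_eq_zero _).2 ⟨y, hy, rfl⟩)
      (fun y hy => Gr.mem_degreeLT.1 hy n le_rfl) ((mem_wedge_iff _ _ x).1 hx)
    rw [← LinearMap.rTensor_comp_map, LinearMap.comp_apply, hcomul x c hc, ← LinearMap.comp_apply,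
      LinearMap.rTensor_comp_map, LinearMap.comp_id] at h1
    exact (mem_wedge_iff _ _ c).2 h1
  · rintro _ ⟨c, hc, rfl⟩
    have hDC : D.map (Gr.toCoradical k C) ≤ coradicalFiltrationPred k C 1 :=
      le_sSup (Gr.simple_map hD)
    have hcn : c ∈ coradicalFiltration k C n := by
      have := wedge_coradicalFiltrationPred_le 1 n (wedge_mono hDC le_rfl hc)
      rwa [add_comm] at this
    set x := Gr.of k C n (Gr.mk k C n ⟨c, hcn⟩) with hx
    have hxc : (coradicalFiltrationPred k C n).mkQ c = Gr.proj k C n x :=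
      (Gr.proj_of_self n (Gr.mk k C n ⟨c, hcn⟩)).symm
    refine ⟨x, ?_, hxc.symm⟩
    have hxn : x ∈ Gr.degreeLT k C (n + 1) := Gr.of_mem_degreeLT (Nat.lt_succ_self n) _
    rw [SetLike.mem_coe, mem_wedge_iff_coeffMap]
    intro f hf
    -- Split `f` into a part vanishing in degree zero, which lowers the degree of `x`, and a part
    -- pulled back from `C`, whose action on `x` in degree `n` is that of `f'` on `c`.
    obtain ⟨f', hf'⟩ := exists_functional_comp_eq Gr.degreeLT_one_inf_ker f
    have h1 : coeffMap (Gr k C) (f - f' ∘ₗ Gr.toCoradical k C) x ∈ Gr.degreeLT k C n := by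
      rw [add_comm] at hxn
      refine (mem_wedge_iff_coeffMap _ _ x).1 (Gr.degreeLT_add_le 1 n hxn) _ fun y hy => ?_
      rw [LinearMap.sub_apply, hf' y hy, sub_self]
    have h2 : coeffMap (Gr k C) (f' ∘ₗ Gr.toCoradical k C) x ∈ Gr.degreeLT k C n := by
      refine Gr.mem_degreeLT.2 fun m hm => ?_
      rcases hm.eq_or_lt with rfl | hlt
      · have h3 := congrArg (sliceLeft _ f') (hcomul x c hxc)
        rw [sliceLeft_map, sliceLeft_map, LinearMap.comp_id] at h3
        refine h3.trans ((Submodule.Quotient.mk_eq_zero _).2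
          ((mem_wedge_iff_coeffMap _ _ c).1 hc f' ?_))
        rintro _ ⟨d, hd, rfl⟩
        exact (hf' d (Gr.simple_le_degreeLT_one hD hd)).symm.trans (hf d hd)
      · exact Gr.mem_degreeLT.1 ((isSubcoalgebra_iff _).1 (Gr.isSubcoalgebra_degreeLT (n + 1)) _ x
          hxn).2 m hlt
    have := add_mem h1 h2
    rwa [coeffMap_sub, LinearMap.sub_apply, sub_add_cancel] at this

/-- Both images are the quotient of `X` by the same subspace. -/
theorem Submodule.fg_map_iff_of_inf_ker_eq {V W W' : Type*} [AddCommGroup V] [Module k V]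
    [AddCommGroup W] [Module k W] [AddCommGroup W'] [Module k W'] {X : Submodule k V}
    {p : V →ₗ[k] W} {q : V →ₗ[k] W'} (h : X ⊓ LinearMap.ker p = X ⊓ LinearMap.ker q) :
    (X.map p).FG ↔ (X.map q).FG := by
  have hker : LinearMap.ker (p.domRestrict X) = LinearMap.ker (q.domRestrict X) := by
    ext x
    have := SetLike.ext_iff.1 h (x : V)
    simpa [Submodule.mem_inf, x.2] using this
  rw [← LinearMap.range_domRestrict, ← LinearMap.range_domRestrict, ← Module.Finite.iff_fg,
    ← Module.Finite.iff_fg, ← Module.Finite.equiv_iff (p.domRestrict X).quotKerEquivRange,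
    ← Module.Finite.equiv_iff (q.domRestrict X).quotKerEquivRange, hker]

/-- The wedge lives in degrees at most `n`, so killing the degree `n` part already puts an element
in degrees below `n`. -/
theorem Gr.wedge_inf_ker_proj {D : Submodule k (Gr k C)} (hD : IsSimpleSubcoalgebra k D) (n : ℕ) :
    wedge k D (Gr.degreeLT k C n) ⊓ LinearMap.ker (Gr.proj k C n) =
      wedge k D (Gr.degreeLT k C n) ⊓ Gr.degreeLT k C n := by
  refine le_antisymm (fun x hx => ⟨hx.1, Gr.mem_degreeLT.2 fun m hm => ?_⟩) fun x hx =>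
    ⟨hx.1, Gr.mem_degreeLT.1 hx.2 n le_rfl⟩
  rcases hm.eq_or_lt with rfl | hlt
  · exact hx.2
  · exact Gr.mem_degreeLT.1 (Gr.wedge_simple_le hD n hx.1) m hlt

theorem Gr.fg_wedge_iff {D : Submodule k (Gr k C)} (hD : IsSimpleSubcoalgebra k D) (n : ℕ) :
    ((wedge k D (coradicalFiltrationPred k (Gr k C) n)).map
      (coradicalFiltrationPred k (Gr k C) n).mkQ).FG ↔
    ((wedge k (D.map (Gr.toCoradical k C)) (coradicalFiltrationPred k C n)).map
        (coradicalFiltrationPred k C n).mkQ).FG := by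
  rw [← Gr.map_proj_wedge hD, Gr.coradicalFiltrationPred_eq]
  refine Submodule.fg_map_iff_of_inf_ker_eq ?_
  rw [Submodule.ker_mkQ, Gr.wedge_inf_ker_proj hD]

theorem Gr.wedge_le_iff {D : Submodule k (Gr k C)} (hD : IsSimpleSubcoalgebra k D) (n : ℕ) :
    wedge k D (coradicalFiltrationPred k (Gr k C) n) ≤ coradicalFiltrationPred k (Gr k C) n ↔
      wedge k (D.map (Gr.toCoradical k C)) (coradicalFiltrationPred k C n) ≤
        coradicalFiltrationPred k C n := by
  have h := Gr.map_proj_wedge hD n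
  rw [Gr.coradicalFiltrationPred_eq, ← inf_eq_left, ← Gr.wedge_inf_ker_proj hD, inf_eq_left,
    LinearMap.le_ker_iff_map, h, ← LinearMap.le_ker_iff_map, Submodule.ker_mkQ]

theorem Gr.isLoewyFinite_iff : IsLoewyFinite k C ↔ IsLoewyFinite k (Gr k C) := by
  constructor
  · intro h D hD
    obtain ⟨h1, N, hN⟩ := h _ (Gr.simple_map hD)
    exact ⟨fun n => (Gr.fg_wedge_iff hD n).2 (h1 n),
      N, fun n hn => (Gr.wedge_le_iff hD n).2 (hN n hn)⟩
  · intro h D hD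
    obtain ⟨D', hD', rfl⟩ := Gr.exists_simple_map_eq hD
    obtain ⟨h1, N, hN⟩ := h _ hD'
    exact ⟨fun n => (Gr.fg_wedge_iff hD' n).1 (h1 n),
      N, fun n hn => (Gr.wedge_le_iff hD' n).1 (hN n hn)⟩

end GrFiltration

theorem theoremA (k : Type u) (C : Type v) [Field k] [AddCommGroup C] [Module k C]
    [Coalgebra k C] : IsLeftSemiperfect k C ↔ IsLeftSemiperfect k (Gr k C) := by
  rw [isLeftSemiperfect_iff_isLoewyFinite, isLeftSemiperfect_iff_isLoewyFinite]
  exact Gr.isLoewyFinite_iff
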